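/- Let $0<\rho<1$ and $\theta\ge 1$ be fixed. There are positive constants $c_{n_z}$ ($n_z\in\mathbb N$), depending only on $n_z$ (and on the fixed parameters $\rho,\theta$), with the following property. Let $A$ be the Laplacian of a finite connected unweighted simple graph $\mathcal G$ on the vertex set $\mathcal V$, let $n_z$ be the maximal number of nonzero entries in a row of $A$, and let $\mathcal V=\mathcal V_1\cup\dots\cup\mathcal V_{n_H}$ be a partition into disjoint nonempty aggregates, each inducing a connected subgraph $\mathcal G_l$. Let $P$ be the matrix whose columns are the indicator vectors of the aggregates, $Q$ the $\ell_2$-orthogonal projection on $\mathrm{range}(P)$ (averaging over each aggregate), and $|v|_A^2=v^TAv$. Let $\lambda_1=\|A\|_{\ell_\infty}$ (maximal absolute row sum), $0<\lambda_0<\lambda_1$, $\kappa=\lambda_1/\lambda_0$, $\delta=(\sqrt\kappa-1)/(\sqrt\kappa+1)$, and let $m\ge 2$ be an integer with $$ M\le m\le\theta(M+1),\qquad M=\frac{1}{|\log\delta|}\max\Big\{\Big|\log\frac{2\rho}{\kappa-1}\Big|,\Big|\log\frac{2}{\lambda_1(\kappa-1)}\Big|\Big\} $$ (the least integer $m\ge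 M$ always satisfies $M\le m\le \theta(M+1)$). Let $q_m$ be the best uniform approximation to $1/x$ on $[\lambda_0,\lambda_1]$ among polynomials of degree at most $m$, and let $R=q_m(A)$, $A_H=P^TAP$, $\pi_A=PA_H^\dagger P^TA$, $E_{TL}=(I-RA)(I-\pi_A)$, where $\dagger$ denotes the Moore–Penrose pseudo-inverse. Let $\Pi=A^\dagger A$ be the orthogonal projection on $(\ker A)^\perp$. Let $E=\Pi E_{TL}\Pi$ be the operator that $E_{TL}$ induces on the energy space (vectors modulo $\ker A$, represented by $(\ker A)^\perp$), let $E^*=A^\dagger E^TA$ be its adjoint in the energy inner product $(u,v)_A=u^TAv$, and let $B=(I-EE^*)A^\dagger$ be the symmetrized two-level preconditioner. For $c_p>0$ and $c_1\in\mathbb R$ put $$K_{TG}=8+8c_1\,[\,c_{n_z}c_pc_s+1\,],\qquad c_s=\frac{\ln^2 m}{m^2}.$$ (a) If $c_p>0$ and $c_1$ are such that $c_p^{-1}\|v-Qv\|^2+|v-Qv|_A^2\le c_1|v|_A^2$ for all $v$, then $$v^TAv\le v^TB^\dagger v\le K_{TG}\,v^TAv\qquad\text{for all } v .$$ (b) If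 $c_p>0$ and $c_0$ are such that $|Qv|_A^2\le c_0|v|_A^2$ and $\|v-Qv\|^2\le c_p|v|_A^2$ for all $v$, then the hypothesis of (a) holds with $c_1=2c_0+3$ and this $c_p$, and hence so does the spectral equivalence in (a), with $c_1=2c_0+3$. (c) Let $\lambda_l$ be the smallest positive eigenvalue of the Laplacian of $\mathcal G_l$ (with $\lambda_l^{-1}:=0$ if $\mathcal V_l$ is a single vertex). If $\lambda_l^{-1}\le c_p$ for all $l$, then $\|v-Qv\|^2\le c_p|v|_A^2$ for all $v$. -/

import Mathlib

open Matrix Polynomial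

noncomputable section

namespace TwoLevel

universe u w

/-! ### Moore-Penrose pseudo-inverse of a real square matrix -/

/-- The four Penrose equations. -/
structure IsMoorePenrose {V : Type u} [Fintype V] (M X : Matrix V V ℝ) : Prop where
  mul_mul_left : M * X * M = M
  mul_mul_right : X * M * X = X
  symm_left : (M * X)ᵀ = M * X
  symm_right : (X * M)ᵀ = X * M

theorem IsMoorePenrose.unique {V : Type u} [Fintype V] {M X Y : Matrix V V ℝ}
    (hX : IsMoorePenrose M X) (hY : IsMoorePenrose M Y) : X = Y := by
  have h1 : M * X = M * Y := by
    calc M * X = (M * X)ᵀ := hX.symm_left.symm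
      _ = ((M * Y) * (M * X))ᵀ := by
          rw [← Matrix.mul_assoc (M * Y) M X, hY.mul_mul_left]
      _ = (M * X)ᵀ * (M * Y)ᵀ := Matrix.transpose_mul _ _
      _ = M * X * (M * Y) := by rw [hX.symm_left, hY.symm_left]
      _ = M * Y := by rw [← Matrix.mul_assoc (M * X) M Y, hX.mul_mul_left]
  have h2 : X * M = Y * M := by
    calc X * M = (X * M)ᵀ := hX.symm_right.symm
      _ = ((X * M) * (Y * M))ᵀ := by
          rw [Matrix.mul_assoc X M (Y * M), ← Matrix.mul_assoc M Y M, hY.mul_mul_left]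
      _ = (Y * M)ᵀ * (X * M)ᵀ := Matrix.transpose_mul _ _
      _ = Y * M * (X * M) := by rw [hX.symm_right, hY.symm_right]
      _ = Y * M := by
          rw [Matrix.mul_assoc Y M (X * M), ← Matrix.mul_assoc M X M, hX.mul_mul_left]
  calc X = X * M * X := hX.mul_mul_right.symm
    _ = Y * M * Y := by rw [Matrix.mul_assoc, h1, ← Matrix.mul_assoc, h2]
    _ = Y := hY.mul_mul_right

theorem exists_isMoorePenrose_symm {V : Type u} [Fintype V] [DecidableEq V]
    (S : Matrix V V ℝ) (hS : S.IsHermitian) : ∃ X, IsMoorePenrose S X ∧ Xᵀ = X := by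
  obtain ⟨U, d, hU, hSd⟩ : ∃ (U : Matrix V V ℝ) (d : V → ℝ), Uᵀ * U = 1 ∧
      S = U * diagonal d * Uᵀ := by
    refine ⟨hS.eigenvectorUnitary, hS.eigenvalues, ?_, ?_⟩
    · have := (Matrix.mem_unitaryGroup_iff').1 hS.eigenvectorUnitary.2
      simpa [Matrix.star_eq_conjTranspose] using this
    · have := hS.spectral_theorem
      simpa [Unitary.conjStarAlgAut_apply, Matrix.star_eq_conjTranspose, Function.comp_def]
        using this
  have key : ∀ a b : V → ℝ, (U * diagonal a * Uᵀ) * (U * diagonal b * Uᵀ)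
      = U * diagonal (fun i => a i * b i) * Uᵀ := by
    intro a b
    calc (U * diagonal a * Uᵀ) * (U * diagonal b * Uᵀ)
        = U * diagonal a * (Uᵀ * U) * diagonal b * Uᵀ := by simp only [Matrix.mul_assoc]
      _ = U * (diagonal a * diagonal b) * Uᵀ := by
          rw [hU, Matrix.mul_one]; simp only [Matrix.mul_assoc]
      _ = _ := by rw [diagonal_mul_diagonal]
  have sym : ∀ a : V → ℝ, (U * diagonal a * Uᵀ)ᵀ = U * diagonal a * Uᵀ := by
    intro a
    simp [Matrix.transpose_mul, Matrix.mul_assoc]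
  refine ⟨U * diagonal (fun i => (d i)⁻¹) * Uᵀ, ⟨?_, ?_, ?_, ?_⟩, sym _⟩
  · rw [hSd, key, key]; congr 3; ext i; simp
  · rw [hSd, key, key]; congr 3; ext i
    by_cases h : d i = 0 <;> simp [h]
  · rw [hSd, key, sym]
  · rw [hSd, key, sym]

theorem exists_isMoorePenrose {V : Type u} [Fintype V] (M : Matrix V V ℝ) :
    ∃ X, IsMoorePenrose M X := by
  classical
  obtain ⟨X, hX, hXs⟩ := exists_isMoorePenrose_symm (Mᵀ * M) (by
    simpa using Matrix.isHermitian_conjTranspose_mul_self M)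
  have h0 : M * (X * (Mᵀ * M)) = M := by
    have hz : (M * (X * (Mᵀ * M)) - M)ᵀ * (M * (X * (Mᵀ * M)) - M) = 0 := by
      have e : Mᵀ * (M * (X * (Mᵀ * M)) - M) = 0 := by
        rw [Matrix.mul_sub, ← Matrix.mul_assoc, ← Matrix.mul_assoc, hX.mul_mul_left, sub_self]
      have e' : M * (X * (Mᵀ * M)) - M = M * (X * (Mᵀ * M) - 1) := by
        rw [Matrix.mul_sub, Matrix.mul_one]
      calc _ = (X * (Mᵀ * M) - 1)ᵀ * (Mᵀ * (M * (X * (Mᵀ * M)) - M)) := by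
            rw [← Matrix.mul_assoc (X * (Mᵀ * M) - 1)ᵀ Mᵀ, ← Matrix.transpose_mul, ← e']
        _ = 0 := by rw [e, Matrix.mul_zero]
    have := (Matrix.conjTranspose_mul_self_eq_zero
      (A := M * (X * (Mᵀ * M)) - M)).1 (by simpa using hz)
    exact sub_eq_zero.1 this
  refine ⟨X * Mᵀ, ⟨?_, ?_, ?_, ?_⟩⟩
  · simpa [Matrix.mul_assoc] using h0
  · simpa [Matrix.mul_assoc] using congrArg (· * Mᵀ) hX.mul_mul_right
  · simp [Matrix.transpose_mul, hXs, Matrix.mul_assoc]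
  · simpa [Matrix.mul_assoc] using hX.symm_right

/-- The Moore-Penrose pseudo-inverse. -/
def pinv {V : Type u} [Fintype V] (M : Matrix V V ℝ) : Matrix V V ℝ :=
  Classical.choose (exists_isMoorePenrose M)

theorem pinv_spec {V : Type u} [Fintype V] (M : Matrix V V ℝ) : IsMoorePenrose M (pinv M) :=
  Classical.choose_spec (exists_isMoorePenrose M)

/-! ### Matrix quantities -/

/-- The squared Euclidean norm. -/
def normSq {V : Type u} [Fintype V] (v : V → ℝ) : ℝ := v ⬝ᵥ v

/-- The squared energy seminorm `|v|_M ^ 2 = vᵀ M v`. -/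
def energySq {V : Type u} [Fintype V] (M : Matrix V V ℝ) (v : V → ℝ) : ℝ := v ⬝ᵥ (M *ᵥ v)

/-- The matrix norm induced by the maximum norm: the largest absolute row sum. -/
def linftyNorm {V : Type u} [Fintype V] (M : Matrix V V ℝ) : ℝ :=
  letI : NormedAddCommGroup (Matrix V V ℝ) := Matrix.linftyOpNormedAddCommGroup
  ‖M‖

/-- The largest number of nonzero entries in a row. -/
def maxRowNonzeros {V : Type u} [Fintype V] (M : Matrix V V ℝ) : ℕ :=
  Finset.univ.sup fun i => {j | M i j ≠ 0}.ncard

/-! ### Aggregation -/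

/-- The map `agg` describes a partition of the vertices into the aggregates
`{i | agg i = l}`; each of them is nonempty and induces a connected subgraph. -/
def IsGraphPartition {V : Type u} {W : Type w} (G : SimpleGraph V) (agg : V → W) : Prop :=
  ∀ l : W, (G.induce {i | agg i = l}).Connected

/-- The unsmoothed aggregation prolongation: column `l` is the indicator of aggregate `l`. -/
def prolongation {V : Type u} {W : Type w} [DecidableEq W] (agg : V → W) : Matrix V W ℝ :=
  Matrix.of fun i l => if agg i = l then 1 else 0

/-- The `ℓ²`-orthogonal projection on the piecewise constant vectors: averaging over each
aggregate. -/
def avgProj {V : Type u} {W : Type w} [Fintype V] [DecidableEq W] (agg : V → W)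
    (v : V → ℝ) : V → ℝ := fun i =>
  (∑ j with agg j = agg i, v j) / ((Finset.univ.filter fun j => agg j = agg i).card : ℝ)

/-- The smallest positive eigenvalue of the Laplacian of the subgraph induced by the aggregate
`l`, as the minimum of the Rayleigh quotient over the nonzero vectors orthogonal to the
constants (`0`, with inverse `0`, if the aggregate has one vertex only). -/
def localEigenvalue {V : Type u} {W : Type w} [Fintype V] [DecidableEq V] [DecidableEq W]
    (G : SimpleGraph V) [DecidableRel G.Adj] (agg : V → W) (l : W) : ℝ :=
  sInf {r : ℝ | ∃ v : {i : V | agg i = l} → ℝ, v ≠ 0 ∧ ∑ i, v i = 0 ∧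
    r = energySq ((G.induce {i : V | agg i = l}).lapMatrix ℝ) v / normSq v}

/-! ### The polynomial smoother -/

/-- The uniform distance between `1 / x` and `p` on `[a, b]`. -/
def recipError (a b : ℝ) (p : ℝ[X]) : ℝ :=
  sSup ((fun x : ℝ => |1 / x - p.eval x|) '' Set.Icc a b)

/-- `q` is a best uniform approximation to `1 / x` on `[a, b]` among all polynomials of degree
at most `m`. -/
def IsBestRecipApprox (a b : ℝ) (m : ℕ) (q : ℝ[X]) : Prop :=
  q.natDegree ≤ m ∧ ∀ p : ℝ[X], p.natDegree ≤ m → recipError a b q ≤ recipError a b p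

/-- The lower bound on the degree which ensures the damping factor `ρ` on `[a, b]` and the
positivity of the polynomial. -/
def degreeBound (ρ a b : ℝ) : ℝ :=
  let κ := b / a
  let δ := (√κ - 1) / (√κ + 1)
  1 / |Real.log δ| * max |Real.log (2 * ρ / (κ - 1))| |Real.log (2 / (b * (κ - 1)))|

/-! ### The two-level preconditioner -/

section Preconditioner

variable {V : Type u} {W : Type w} [Fintype V] [DecidableEq V] [Fintype W]

/-- The coarse-grid correction `π_A = P A_H† Pᵀ A`, with `A_H = Pᵀ A P`. -/
def coarseCorrection (A : Matrix V V ℝ) (P : Matrix V W ℝ) : Matrix V V ℝ :=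
  P * pinv (Pᵀ * A * P) * Pᵀ * A

/-- The error propagation matrix `E_TL = (I - R A) (I - π_A)`. -/
def errorProp (A R : Matrix V V ℝ) (P : Matrix V W ℝ) : Matrix V V ℝ :=
  (1 - R * A) * (1 - coarseCorrection A P)

/-- The operator induced by `X` on the energy space: `(u, v)_A` is an inner product on vectors
modulo `ker A`, and each class is represented by its member in `(ker A)ᗮ`. The matrix
`pinv A * A` is the orthogonal projection on `(ker A)ᗮ` (for symmetric `A`). -/
def onEnergySpace (A X : Matrix V V ℝ) : Matrix V V ℝ :=
  (pinv A * A) * X * (pinv A * A)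

/-- The adjoint on the energy space with respect to `(u, v)_A = uᵀ A v`. -/
def energyAdjoint (A X : Matrix V V ℝ) : Matrix V V ℝ :=
  pinv A * Xᵀ * A

/-- The symmetrized two-level preconditioner `B = (I - E E^*) A†`, where `E` is the operator on the
energy space induced by `E_TL`. -/
def preconditioner (A R : Matrix V V ℝ) (P : Matrix V W ℝ) : Matrix V V ℝ :=
  let E := onEnergySpace A (errorProp A R P)
  (1 - E * energyAdjoint A E) * pinv A

end Preconditioner

/-! ### The assumptions on the coarse space and the constant -/

/-- The combined approximation and stability assumption on the projection `Q`:
`c_p⁻¹ ‖v - Q v‖ ^ 2 + |v - Q v|_A ^ 2 ≤ c₁ |v|_A ^ 2`. -/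
def ApproxStable {V : Type u} [Fintype V] (A : Matrix V V ℝ) (Q : (V → ℝ) → V → ℝ)
    (cp c₁ : ℝ) : Prop :=
  ∀ v : V → ℝ, cp⁻¹ * normSq (v - Q v) + energySq A (v - Q v) ≤ c₁ * energySq A v

/-- The weak approximation property `‖v - Q v‖ ^ 2 ≤ c_p |v|_A ^ 2`. -/
def WeakApprox {V : Type u} [Fintype V] (A : Matrix V V ℝ) (Q : (V → ℝ) → V → ℝ)
    (cp : ℝ) : Prop :=
  ∀ v : V → ℝ, normSq (v - Q v) ≤ cp * energySq A v

/-- The stability of `Q` in the energy seminorm, `|Q v|_A ^ 2 ≤ c₀ |v|_A ^ 2`. -/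
def EnergyStable {V : Type u} [Fintype V] (A : Matrix V V ℝ) (Q : (V → ℝ) → V → ℝ)
    (c₀ : ℝ) : Prop :=
  ∀ v : V → ℝ, energySq A (Q v) ≤ c₀ * energySq A v

/-- `K_TG = 8 + 8 c₁ (c_nz c_p c_s + 1)` with `c_s = (ln m) ^ 2 / m ^ 2`. -/
def twoGridConst (cnz cp c₁ : ℝ) (m : ℕ) : ℝ :=
  8 + 8 * c₁ * (cnz * cp * (Real.log m ^ 2 / (m : ℝ) ^ 2) + 1)

/-- `vᵀ A v ≤ vᵀ B† v ≤ K vᵀ A v` for all `v`. -/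
def SpectrallyEquivalent {V : Type u} [Fintype V] (A B : Matrix V V ℝ) (K : ℝ) : Prop :=
  ∀ v : V → ℝ, energySq A v ≤ energySq (pinv B) v ∧ energySq (pinv B) v ≤ K * energySq A v

end TwoLevel

end

open Matrix Polynomial

noncomputable section

namespace TwoLevel

/-! ### Alternation and uniqueness of best approximations -/

/-! The best approximation `q` is explicit. Map `[λ₀, λ₁]` affinely onto `[-1, 1]`, reversing
orientation, so that `0` goes to `A = (δ + δ⁻¹) / 2 > 1`. Then `1 - x q(x) = N(t) / N(A)` with `N =
T_{m+1} - 2δ T_m + δ² T_{m-1}`. On `[-1, 1]`, `|N(t)|` is at most `1 - 2δt + δ² = 2δ(A - t)`, a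
multiple of `x`, and equality holds with alternating signs at `m + 2` points. Alternation forces
every best approximation to be this one (`eq_zero_of_alternating`, `IsBestRecipApprox.spec`). On
`[1, A]`, `N` is nonnegative and lies below its chord (`chordBounded_errorNumerator`), which
controls `q` on `[0, λ₀]`, below the interval of approximation.

The lower bound on `m` makes `λ₁` times the optimal error at most `1 / 2`. The symmetrized smoother
`q (2 - x q)` is then positive on the whole positive spectrum and dominates what Cauchy-Schwarz
requires (`IsBestRecipApprox.symbol_bounds`).

The energy of `B` is a smoother term plus a coarse term. With `u = B† v`, one has `vᵀ B† v = 2 uᵀ v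
- uᵀ B u`. Splitting `v` into a fine part and a smoothed coarse part `(1 - R A) P z`, and applying
Cauchy-Schwarz to each, bounds this by `8 |v|_A² + 4 λ₀ ‖v - P z‖² + 8 |v - P z|_A²`. The lower
bound comes from `B ≤ A†`. Both are in `spectralEquivalence_of_symbol_bounds`.

Finally the upper bound on `m` gives `m² ≲ κ ln² m`, that is `λ₀ ≲ λ₁ ln² m / m²`, where `λ₁ ≤ 2
n_z` (`exists_le_log_sq_div_sq`). Taking `P z = Q v` gives (a). Part (b) is the parallelogram
inequality, and (c) is the Poincaré inequality on each aggregate, summed. -/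

/-- Exactly the `n - i` factors with `j > i` are negative, and `n - i` has the parity of `n + i`. -/
theorem neg_one_pow_mul_prod_sub_pos {n : ℕ} {x : ℕ → ℝ}
    (hx : ∀ i j, i < j → j ≤ n → x i < x j) {i : ℕ} (hi : i ≤ n) :
    0 < (-1) ^ (n + i) * ∏ j ∈ (Finset.range (n + 1)).erase i, (x i - x j) := by
  have h₁ : 0 < ∏ j ∈ Finset.range i, (x i - x j) :=
    Finset.prod_pos fun j hj => sub_pos.2 (hx j i (Finset.mem_range.1 hj) hi)
  have h₂ : 0 < ∏ j ∈ Finset.Ioc i n, ((-1) * (x i - x j)) :=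
    Finset.prod_pos fun j hj => by
      have := hx i j (Finset.mem_Ioc.1 hj).1 (Finset.mem_Ioc.1 hj).2
      linarith
  have hu : (Finset.range (n + 1)).erase i = Finset.range i ∪ Finset.Ioc i n := by
    ext j; simp only [Finset.mem_erase, Finset.mem_range, Finset.mem_union, Finset.mem_Ioc]; omega
  have hd : Disjoint (Finset.range i) (Finset.Ioc i n) := by
    rw [Finset.disjoint_left]; intro j; simp only [Finset.mem_range, Finset.mem_Ioc]; omega
  rw [hu, Finset.prod_union hd]
  rw [Finset.prod_mul_distrib, Finset.prod_const, Nat.card_Ioc] at h₂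
  have hs : (-1 : ℝ) ^ (n + i) = (-1) ^ (n - i) := by
    rw [show n + i = (n - i) + 2 * i by omega, pow_add, pow_mul]; simp
  rw [hs]
  nlinarith [mul_pos h₁ h₂]

/-- A polynomial of degree at most `n` which weakly alternates in sign at `n + 2` increasing
points vanishes. -/
theorem eq_zero_of_alternating {n : ℕ} {x : ℕ → ℝ}
    (hx : ∀ i j, i < j → j ≤ n + 1 → x i < x j) {r : ℝ[X]} (hr : r.natDegree ≤ n)
    (h : ∀ i ≤ n + 1, 0 ≤ (-1) ^ i * r.eval (x i)) : r = 0 := by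
  have hinj : Set.InjOn x (Finset.range (n + 2)) := by
    intro i hi j hj hij
    simp only [Finset.coe_range, Set.mem_Iio] at hi hj
    rcases lt_trichotomy i j with hl | hl | hl
    · exact absurd hij (hx i j hl (by omega)).ne
    · exact hl
    · exact absurd hij (hx j i hl (by omega)).ne'
  have hdeg : r.degree < (Finset.range (n + 2)).card := by
    rw [Finset.card_range]
    exact lt_of_le_of_lt degree_le_natDegree (by exact_mod_cast (by omega : r.natDegree < n + 2))
  -- The coefficient of degree `n + 1` vanishes and equals the divided difference over the `n + 2`
  -- points. All its terms have one sign, so each of them is zero.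
  have hsum := Lagrange.coeff_eq_sum hinj hdeg
  rw [Finset.card_range, coeff_eq_zero_of_natDegree_lt (by omega)] at hsum
  have hterm : ∀ i ∈ Finset.range (n + 2), 0 ≤ (-1) ^ (n + 1) *
      (r.eval (x i) / ∏ j ∈ (Finset.range (n + 2)).erase i, (x i - x j)) := by
    intro i hi
    have hi' : i ≤ n + 1 := by have := Finset.mem_range.1 hi; omega
    have hp := neg_one_pow_mul_prod_sub_pos hx hi'
    have e : (-1 : ℝ) ^ (n + 1) *
        (r.eval (x i) / ∏ j ∈ (Finset.range (n + 2)).erase i, (x i - x j)) =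
        ((-1) ^ i * r.eval (x i)) /
          ((-1) ^ (n + 1 + i) * ∏ j ∈ (Finset.range (n + 2)).erase i, (x i - x j)) := by
      have hp' := right_ne_zero_of_mul hp.ne'
      have h1 : (-1 : ℝ) ^ (n + 1) * (-1) ^ (n + 1) = 1 := by rw [← mul_pow]; simp
      have h2 := div_mul_cancel₀ (r.eval (x i)) hp'
      rw [eq_div_iff hp.ne', pow_add _ (n + 1) i]
      linear_combination (-1) ^ (n + 1) * (-1) ^ (n + 1) * (-1) ^ i * h2 +
        (-1) ^ i * r.eval (x i) * h1
    rw [e]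
    exact div_nonneg (h i hi') hp.le
  have hz : ∑ i ∈ Finset.range (n + 2), (-1) ^ (n + 1) *
      (r.eval (x i) / ∏ j ∈ (Finset.range (n + 2)).erase i, (x i - x j)) = 0 := by
    rw [← Finset.mul_sum, ← hsum, mul_zero]
  have hall := (Finset.sum_eq_zero_iff_of_nonneg hterm).1 hz
  refine eq_zero_of_degree_lt_of_eval_index_eq_zero _ hinj hdeg ?_
  intro i hi
  have hi' : i ≤ n + 1 := by have := Finset.mem_range.1 hi; omega
  have hp := right_ne_zero_of_mul (neg_one_pow_mul_prod_sub_pos hx hi').ne'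
  have := hall i hi
  rw [mul_eq_zero, div_eq_zero_iff] at this
  rcases this with h1 | h1 | h1
  · exact absurd h1 (by simp)
  · exact h1
  · exact absurd h1 hp

/-- A continuous function increasing from `0` to `n * c` attains the multiples of `c` at an
increasing sequence of points. -/
theorem exists_increasing_seq_eq_mul {a b c : ℝ} (hab : a ≤ b) (hc : 0 < c) {f : ℝ → ℝ}
    (hf : ContinuousOn f (Set.Icc a b)) {n : ℕ} (ha : f a = 0) (hb : f b = n * c) :
    ∃ x : ℕ → ℝ, (∀ i j, i < j → j ≤ n → x i < x j) ∧
      ∀ i ≤ n, x i ∈ Set.Icc a b ∧ f (x i) = i * c := by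
  -- The hypotheses stand inside the existential so that `choose` yields a total function to
  -- iterate; where they fail the value `0` is arbitrary.
  have step : ∀ (k : ℕ) (x : ℝ), ∃ y, x ∈ Set.Icc a b → f x = k * c → k < n →
      x < y ∧ y ∈ Set.Icc a b ∧ f y = (k + 1 : ℕ) * c := by
    intro k x
    by_cases h : x ∈ Set.Icc a b ∧ f x = k * c ∧ k < n
    · obtain ⟨hx, hfx, hk⟩ := h
      have hk1 : ((k + 1 : ℕ) : ℝ) ≤ n := by exact_mod_cast hk
      have hmem : ((k + 1 : ℕ) : ℝ) * c ∈ Set.Icc (f x) (f b) := by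
        rw [hfx, hb]
        refine ⟨?_, by gcongr⟩
        gcongr; simp
      obtain ⟨y, hy, hfy⟩ := intermediate_value_Icc hx.2
        (hf.mono (Set.Icc_subset_Icc_left hx.1)) hmem
      refine ⟨y, fun _ _ _ => ⟨lt_of_le_of_ne hy.1 ?_, ⟨hx.1.trans hy.1, hy.2⟩, hfy⟩⟩
      rintro rfl
      rw [hfx] at hfy
      push_cast at hfy
      nlinarith
    · exact ⟨0, fun h1 h2 h3 => absurd ⟨h1, h2, h3⟩ h⟩
  choose g hg using step
  let x : ℕ → ℝ := fun k => Nat.rec a g k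
  have hx : ∀ i ≤ n, x i ∈ Set.Icc a b ∧ f (x i) = i * c := by
    intro i
    induction i with
    | zero => intro _; exact ⟨⟨le_rfl, hab⟩, by simpa [x] using ha⟩
    | succ k ih =>
      intro hk
      obtain ⟨h1, h2⟩ := ih (by omega)
      exact (hg k (x k) h1 h2 (by omega)).2
  have hlt : ∀ k < n, x k < x (k + 1) := fun k hk =>
    (hg k (x k) (hx k hk.le).1 (hx k hk.le).2 hk).1
  refine ⟨x, ?_, hx⟩
  intro i j hij
  induction j, hij using Nat.le_induction with
  | base => intro hj; exact hlt i hj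
  | succ j _ ih => intro hj; exact (ih (by omega)).trans (hlt j (by omega))

/-! ### The extremal polynomial for the approximation of `1 / x` -/

/-- The numerator of the error of the best approximation to `1 / (a - t)` on `[-1, 1]` of degree
`n + 1`, where `2 * a = δ + δ⁻¹`. -/
def errorNumerator (δ : ℝ) (n : ℕ) : ℝ[X] :=
  Chebyshev.T ℝ (n + 2 : ℕ) - C (2 * δ) * Chebyshev.T ℝ (n + 1 : ℕ) + C (δ ^ 2) * Chebyshev.T ℝ n

theorem natDegree_errorNumerator_le (δ : ℝ) (n : ℕ) :
    (errorNumerator δ n).natDegree ≤ n + 2 := by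
  have h : ∀ k : ℕ, (Chebyshev.T ℝ k).natDegree = k := fun k => by
    rw [Chebyshev.natDegree_T]; simp
  unfold errorNumerator
  refine (natDegree_add_le _ _).trans (max_le ((natDegree_sub_le _ _).trans (max_le ?_ ?_)) ?_)
  · rw [h]
  · exact (natDegree_C_mul_le _ _).trans (by rw [h]; omega)
  · exact (natDegree_C_mul_le _ _).trans (by rw [h]; omega)

theorem eval_errorNumerator (δ : ℝ) (n : ℕ) (t : ℝ) : (errorNumerator δ n).eval t =
    (Chebyshev.T ℝ (n + 2 : ℕ)).eval t - 2 * δ * (Chebyshev.T ℝ (n + 1 : ℕ)).eval t +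
      δ ^ 2 * (Chebyshev.T ℝ n).eval t := by
  simp [errorNumerator]

theorem eval_chebyshev_add_two (n : ℕ) (t : ℝ) : (Chebyshev.T ℝ (n + 2 : ℕ)).eval t =
    2 * t * (Chebyshev.T ℝ (n + 1 : ℕ)).eval t - (Chebyshev.T ℝ n).eval t := by
  push_cast
  simp

/-- The denominator of the phase of the error function is positive. -/
theorem one_sub_mul_cos_pos {δ : ℝ} (h0 : 0 < δ) (h1 : δ < 1) (φ : ℝ) :
    0 < 1 - δ * Real.cos φ := by
  nlinarith [Real.cos_le_one φ]

/-- The phase of the error function. -/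
def errorPhase (δ : ℝ) (n : ℕ) (φ : ℝ) : ℝ :=
  (n + 2 : ℕ) * φ + 2 * Real.arctan (δ * Real.sin φ / (1 - δ * Real.cos φ))

theorem continuous_errorPhase {δ : ℝ} (h0 : 0 < δ) (h1 : δ < 1) (n : ℕ) :
    Continuous (errorPhase δ n) := by
  unfold errorPhase
  have := fun φ => (one_sub_mul_cos_pos h0 h1 φ).ne'
  have h2 : Continuous fun φ : ℝ => δ * Real.sin φ / (1 - δ * Real.cos φ) :=
    Continuous.div (by fun_prop) (by fun_prop) this
  exact (by fun_prop : Continuous fun φ : ℝ => ((n + 2 : ℕ) : ℝ) * φ).add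
    (continuous_const.mul (Real.continuous_arctan.comp h2))

/-- The left side is the real part of `e^{i(n+2)φ} (1 - δ e^{-iφ})²`. The factor `1 - δ e^{-iφ}` has
squared modulus `1 - 2δ cos φ + δ²` and argument the arctangent in `errorPhase`. In the proof `y` is
the tangent of that argument. -/
theorem eval_errorNumerator_cos {δ : ℝ} (h0 : 0 < δ) (h1 : δ < 1) (n : ℕ) (φ : ℝ) :
    (errorNumerator δ n).eval (Real.cos φ) =
      (1 - 2 * δ * Real.cos φ + δ ^ 2) * Real.cos (errorPhase δ n φ) := by
  have hD := one_sub_mul_cos_pos h0 h1 φ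
  set y := δ * Real.sin φ / (1 - δ * Real.cos φ) with hy
  have hcos2 : Real.cos (2 * Real.arctan y) = (1 - y ^ 2) / (1 + y ^ 2) := by
    rw [Real.cos_two_mul, Real.cos_sq_arctan]
    have : 1 + y ^ 2 ≠ 0 := by positivity
    field_simp; ring
  have hsin2 : Real.sin (2 * Real.arctan y) = 2 * y / (1 + y ^ 2) := by
    rw [Real.sin_two_mul, Real.sin_arctan, Real.cos_arctan]
    have h3 : 0 < 1 + y ^ 2 := by positivity
    have h2 : √(1 + y ^ 2) ≠ 0 := (Real.sqrt_pos.2 h3).ne'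
    rw [show 2 * (y / √(1 + y ^ 2)) * (1 / √(1 + y ^ 2)) = 2 * y / (√(1 + y ^ 2)) ^ 2 by
      field_simp, Real.sq_sqrt h3.le]
  have hρ : 1 - 2 * δ * Real.cos φ + δ ^ 2 = (1 - δ * Real.cos φ) ^ 2 * (1 + y ^ 2) := by
    rw [hy]; field_simp
    linear_combination (-δ ^ 2) * Real.sin_sq_add_cos_sq φ
  have hT : ∀ k : ℕ, (Chebyshev.T ℝ k).eval (Real.cos φ) = Real.cos (k * φ) := fun k => by
    rw [Chebyshev.T_real_cos]; simp
  have hc1 : Real.cos ((n + 1 : ℕ) * φ) = Real.cos ((n + 2 : ℕ) * φ) * Real.cos φ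
      + Real.sin ((n + 2 : ℕ) * φ) * Real.sin φ := by
    rw [← Real.cos_sub]; push_cast; congr 1; ring
  have hc2 : Real.cos ((n : ℕ) * φ) = Real.cos ((n + 2 : ℕ) * φ) * (2 * Real.cos φ ^ 2 - 1)
      + Real.sin ((n + 2 : ℕ) * φ) * (2 * Real.sin φ * Real.cos φ) := by
    rw [← Real.cos_two_mul, ← Real.sin_two_mul, ← Real.cos_sub]; push_cast; congr 1; ring
  rw [eval_errorNumerator, hT, hT, hT, hc1, hc2, errorPhase, Real.cos_add, ← hy, hcos2, hsin2, hρ]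
  have h3 : 1 + y ^ 2 ≠ 0 := by positivity
  have hyD : y * (1 - δ * Real.cos φ) = δ * Real.sin φ := by rw [hy]; field_simp
  have e1 : (1 - δ * Real.cos φ) ^ 2 * (1 + y ^ 2) *
      (Real.cos ((n + 2 : ℕ) * φ) * ((1 - y ^ 2) / (1 + y ^ 2)) -
        Real.sin ((n + 2 : ℕ) * φ) * (2 * y / (1 + y ^ 2))) =
      Real.cos ((n + 2 : ℕ) * φ) * ((1 - δ * Real.cos φ) ^ 2 - (y * (1 - δ * Real.cos φ)) ^ 2) -
      Real.sin ((n + 2 : ℕ) * φ) * (2 * (y * (1 - δ * Real.cos φ)) * (1 - δ * Real.cos φ)) := by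
    field_simp
  rw [e1, hyD]
  linear_combination (Real.cos ((n + 2 : ℕ) * φ) * δ ^ 2) * Real.sin_sq_add_cos_sq φ

theorem abs_eval_errorNumerator_le {δ : ℝ} (h0 : 0 < δ) (h1 : δ < 1) (n : ℕ) {t : ℝ}
    (ht : t ∈ Set.Icc (-1) 1) :
    |(errorNumerator δ n).eval t| ≤ 1 - 2 * δ * t + δ ^ 2 := by
  have hp : 0 ≤ 1 - 2 * δ * t + δ ^ 2 := by nlinarith [ht.1, ht.2, sq_nonneg (1 - δ)]
  rw [← Real.cos_arccos ht.1 ht.2] at hp ⊢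
  rw [eval_errorNumerator_cos h0 h1, abs_mul, abs_of_nonneg hp]
  exact mul_le_of_le_one_right hp (Real.abs_cos_le_one _)

/-- The phase runs continuously from `0` at `φ = 0` to `(n + 2) π` at `φ = π`, so it meets every
multiple of `π` in between. This gives `n + 3` points, one more than the number of coefficients of a
polynomial of degree `n + 1`. -/
theorem exists_alternation_errorNumerator {δ : ℝ} (h0 : 0 < δ) (h1 : δ < 1) (n : ℕ) :
    ∃ t : ℕ → ℝ, (∀ i j, i < j → j ≤ n + 2 → t j < t i) ∧ ∀ i ≤ n + 2, t i ∈ Set.Icc (-1) 1 ∧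
      (errorNumerator δ n).eval (t i) = (-1) ^ i * (1 - 2 * δ * t i + δ ^ 2) := by
  obtain ⟨φ, hφ, hφ'⟩ := exists_increasing_seq_eq_mul (n := n + 2) Real.pi_pos.le Real.pi_pos
    (continuous_errorPhase h0 h1 n).continuousOn (by simp [errorPhase]) (by simp [errorPhase])
  refine ⟨fun i => Real.cos (φ i), fun i j hij hj => ?_, fun i hi => ⟨?_, ?_⟩⟩
  · exact Real.cos_lt_cos_of_nonneg_of_le_pi (hφ' i (by omega)).1.1 (hφ' j hj).1.2 (hφ i j hij hj)
  · exact ⟨Real.neg_one_le_cos _, Real.cos_le_one _⟩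
  · rw [eval_errorNumerator_cos h0 h1, (hφ' i hi).2, Real.cos_nat_mul_pi]; ring

/-- Here `T_k` takes the value `(δ^k + δ^{-k}) / 2`. The positive powers cancel in the combination,
and the negative ones leave the square. -/
theorem eval_errorNumerator_self {δ : ℝ} (h0 : 0 < δ) (n : ℕ) :
    (errorNumerator δ n).eval ((δ + δ⁻¹) / 2) = (1 - δ ^ 2) ^ 2 / (2 * δ ^ (n + 2)) := by
  have hT : ∀ k : ℕ, (Chebyshev.T ℝ k).eval ((δ + δ⁻¹) / 2) = (δ ^ k + (δ ^ k)⁻¹) / 2 ∧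
      (Chebyshev.T ℝ (k + 1 : ℕ)).eval ((δ + δ⁻¹) / 2) = (δ ^ (k + 1) + (δ ^ (k + 1))⁻¹) / 2 := by
    intro k
    induction k with
    | zero => simp
    | succ k ih =>
      refine ⟨ih.2, ?_⟩
      rw [eval_chebyshev_add_two, ih.1, ih.2]
      field_simp
      ring
  rw [eval_errorNumerator, (hT n).1, (hT n).2, (hT (n + 1)).2]
  field_simp
  ring

/-! ### Growth outside the interval -/

/-- Nonnegativity, the bound by the end value and the chord inequality on `[1, a]`. -/
structure ChordBounded (a : ℝ) (f : ℝ → ℝ) : Prop where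
  nonneg : ∀ t ∈ Set.Icc 1 a, 0 ≤ f t
  le_end : ∀ t ∈ Set.Icc 1 a, f t ≤ f a
  chord : ∀ t ∈ Set.Icc 1 a, (a - 1) * f t ≤ (a - t) * f 1 + (t - 1) * f a

namespace ChordBounded

variable {a : ℝ} {f g : ℝ → ℝ}

theorem add (hf : ChordBounded a f) (hg : ChordBounded a g) :
    ChordBounded a (fun t => f t + g t) where
  nonneg t ht := add_nonneg (hf.nonneg t ht) (hg.nonneg t ht)
  le_end t ht := add_le_add (hf.le_end t ht) (hg.le_end t ht)
  chord t ht := by linarith [hf.chord t ht, hg.chord t ht]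

theorem const_mul (hf : ChordBounded a f) {c : ℝ} (hc : 0 ≤ c) :
    ChordBounded a (fun t => c * f t) where
  nonneg t ht := mul_nonneg hc (hf.nonneg t ht)
  le_end t ht := mul_le_mul_of_nonneg_left (hf.le_end t ht) hc
  chord t ht := by linarith [mul_le_mul_of_nonneg_left (hf.chord t ht) hc]

/-- The product vanishes at `1`, so its chord inequality reduces to `f t ≤ f a`. This is what
`le_end` is for. -/
theorem sub_one_mul (hf : ChordBounded a f) : ChordBounded a (fun t => (t - 1) * f t) where
  nonneg t ht := mul_nonneg (sub_nonneg.2 ht.1) (hf.nonneg t ht)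
  le_end t ht := mul_le_mul (by linarith [ht.2]) (hf.le_end t ht) (hf.nonneg t ht)
    (by linarith [ht.1, ht.2])
  chord t ht := by
    have h1 : 0 ≤ (a - 1) * (t - 1) := mul_nonneg (by linarith [ht.1, ht.2]) (by linarith [ht.1])
    have := mul_le_mul_of_nonneg_left (hf.le_end t ht) h1
    linarith

end ChordBounded

/-- The increments satisfy `T_{n+2} - T_{n+1} = (T_{n+1} - T_n) + 2 (t - 1) T_{n+1}`, which uses
only operations that preserve `ChordBounded`. -/
theorem chordBounded_chebyshev (a : ℝ) (n : ℕ) :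
    ChordBounded a (fun t => (Chebyshev.T ℝ n).eval t) ∧
      ChordBounded a (fun t => (Chebyshev.T ℝ (n + 1 : ℕ)).eval t - (Chebyshev.T ℝ n).eval t) := by
  have h1 : ChordBounded a (fun _ => (1 : ℝ)) :=
    ⟨fun _ _ => zero_le_one, fun _ _ => le_rfl, fun t _ => by linarith⟩
  induction n with
  | zero => exact ⟨by simpa using h1, by simpa using h1.sub_one_mul⟩
  | succ n ih =>
    have hs : ChordBounded a (fun t => (Chebyshev.T ℝ (n + 1 : ℕ)).eval t) := by
      convert ih.1.add ih.2 using 2; ring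
    refine ⟨hs, ?_⟩
    convert ih.2.add (hs.sub_one_mul.const_mul (c := 2) (by norm_num)) using 2
    rw [eval_chebyshev_add_two]; ring

/-- `N = 2 (t - 1) T_{n+1} + 2 (1 - δ)(T_{n+1} - T_n) + (1 - δ)² T_n`, with nonnegative
coefficients. -/
theorem chordBounded_errorNumerator (a : ℝ) {δ : ℝ} (h1 : δ < 1) (n : ℕ) :
    ChordBounded a (fun t => (errorNumerator δ n).eval t) := by
  obtain ⟨hT, hD⟩ := chordBounded_chebyshev a n
  have hT' := (chordBounded_chebyshev a (n + 1)).1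
  convert ((hT'.sub_one_mul.const_mul (c := 2) (by norm_num)).add
    (hD.const_mul (c := 2 * (1 - δ)) (by linarith))).add
    (hT.const_mul (sq_nonneg (1 - δ))) using 2
  rw [eval_errorNumerator, eval_chebyshev_add_two]; ring

/-! ### The best approximation to `1 / x` on `[a, b]` -/

/-- The error of the best uniform approximation to `1 / x` on `[a, b]` of degree `m`. -/
def optimalError (a b : ℝ) (m : ℕ) : ℝ :=
  (b / a - 1) * ((√(b / a) - 1) / (√(b / a) + 1)) ^ m / (2 * b)

theorem abs_sub_le_recipError {a b : ℝ} (ha : 0 < a) (p : ℝ[X]) {x : ℝ} (hx : x ∈ Set.Icc a b) :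
    |1 / x - p.eval x| ≤ recipError a b p := by
  refine le_csSup (IsCompact.bddAbove ?_) ⟨x, hx, rfl⟩
  refine isCompact_Icc.image_of_continuousOn (ContinuousOn.abs (ContinuousOn.sub ?_ ?_))
  · exact continuousOn_const.div continuousOn_id fun y hy => (ha.trans_le hy.1).ne'
  · exact p.continuous.continuousOn

theorem recipError_le {a b E : ℝ} (hab : a ≤ b) {p : ℝ[X]}
    (h : ∀ x ∈ Set.Icc a b, |1 / x - p.eval x| ≤ E) : recipError a b p ≤ E := by
  refine csSup_le ((Set.nonempty_Icc.2 hab).image _) ?_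
  rintro _ ⟨x, hx, rfl⟩
  exact h x hx

/-- The affine change of variables and the polynomial of best approximation. -/
theorem exists_alternating_recipApprox {a b : ℝ} (ha : 0 < a) (hab : a < b) (n : ℕ) :
    ∃ p : ℝ[X], p.natDegree ≤ n + 1 ∧
      (∀ x ∈ Set.Icc a b, |1 / x - p.eval x| ≤ optimalError a b (n + 1)) ∧
      (∃ y : ℕ → ℝ, (∀ i j, i < j → j ≤ n + 2 → y i < y j) ∧ ∀ i ≤ n + 2, y i ∈ Set.Icc a b ∧
        1 / y i - p.eval (y i) = (-1) ^ i * optimalError a b (n + 1)) ∧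
      ∀ x ∈ Set.Icc 0 a, 0 ≤ 1 - x * p.eval x ∧
        1 - x * p.eval x ≤ 1 - x / a * (1 - a * optimalError a b (n + 1)) := by
  -- In terms of `s = √κ` and `a`, the quantities `b`, `δ`, `h` and `A` are all rational.
  obtain ⟨s, hs1, hsκ⟩ : ∃ s : ℝ, 1 < s ∧ √(b / a) = s :=
    ⟨_, by rw [Real.lt_sqrt zero_le_one, one_pow, one_lt_div ha]; exact hab, rfl⟩
  have hκ : b / a = s ^ 2 := by rw [← hsκ, Real.sq_sqrt (div_nonneg (ha.trans hab).le ha.le)]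
  have hb : b = a * s ^ 2 := by rw [← hκ]; field_simp
  set E := optimalError a b (n + 1) with hE
  obtain ⟨δ, hδ⟩ : ∃ δ, δ = (s - 1) / (s + 1) := ⟨_, rfl⟩
  have hs0 : 0 < s - 1 := by linarith
  have hδ0 : 0 < δ := by rw [hδ]; exact div_pos hs0 (by linarith)
  have hδ1 : δ < 1 := by rw [hδ, div_lt_one (by linarith)]; linarith
  have hh : 0 < a * (s ^ 2 - 1) / 2 := by
    have : 0 < s ^ 2 - 1 := by nlinarith
    positivity
  set h := a * (s ^ 2 - 1) / 2 with hhdef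
  set A := (δ + δ⁻¹) / 2 with hA
  have hAs : A = (s ^ 2 + 1) / (s ^ 2 - 1) := by
    have : s ^ 2 - 1 ≠ 0 := by nlinarith
    rw [hA, hδ]; field_simp; ring
  set N := errorNumerator δ n with hN
  have hNA : N.eval A = (1 - δ ^ 2) ^ 2 / (2 * δ ^ (n + 2)) := eval_errorNumerator_self hδ0 n
  have hNpos : 0 < N.eval A := by
    rw [hNA]
    have : 0 < 1 - δ ^ 2 := by nlinarith
    positivity
  have hEN : E = 4 / (a * (s + 1) ^ 2 * N.eval A) := by
    have hs2 : s + 1 ≠ 0 := by positivity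
    have e : 1 - δ ^ 2 = 4 * s / (s + 1) ^ 2 := by rw [hδ]; field_simp; ring
    have e2 : (s - 1) = δ * (s + 1) := by rw [hδ]; field_simp
    rw [hE, optimalError, hsκ, hκ, ← hδ, hNA, e, hb]
    have e3 : s ^ 2 - 1 = δ * (s + 1) ^ 2 := by linear_combination (s + 1) * e2
    rw [e3, pow_succ δ (n + 1)]
    field_simp
    norm_num
  -- `M` is to be `x p(x)`. It vanishes at `0` because `x = 0` corresponds to `t = A`, so `p =
  -- M.divX` has degree one less.
  set M : ℝ[X] := 1 - C (N.eval A)⁻¹ * N.comp (C A - C h⁻¹ * X) with hM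
  have hMeval : ∀ x, M.eval x = 1 - N.eval (A - x / h) / N.eval A := by
    intro x
    simp only [hM, eval_sub, eval_one, eval_mul, eval_C, eval_comp, eval_X]
    rw [div_eq_inv_mul, div_eq_inv_mul]
  have hMX : X * M.divX = M := by
    conv_rhs => rw [← M.X_mul_divX_add]
    have : M.coeff 0 = 0 := by
      rw [coeff_zero_eq_eval_zero, hMeval, zero_div, sub_zero, div_self hNpos.ne', sub_self]
    rw [this, C_0, add_zero]
  have hMdeg : M.natDegree ≤ n + 2 := by
    refine (natDegree_sub_le _ _).trans (max_le (by simp) ?_)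
    refine (natDegree_C_mul_le _ _).trans (natDegree_comp_le.trans ?_)
    have h1 : (C A - C h⁻¹ * X : ℝ[X]).natDegree ≤ 1 := by
      refine (natDegree_sub_le _ _).trans (max_le (by simp) ?_)
      exact (natDegree_C_mul_le _ _).trans natDegree_X_le
    calc N.natDegree * (C A - C h⁻¹ * X : ℝ[X]).natDegree ≤ (n + 2) * 1 :=
          Nat.mul_le_mul (natDegree_errorNumerator_le δ n) h1
      _ = n + 2 := mul_one _
  have hp : ∀ x, 1 - x * M.divX.eval x = N.eval (A - x / h) / N.eval A := by
    intro x
    have := congrArg (eval x) hMX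
    rw [eval_mul, eval_X, hMeval] at this
    linarith
  -- The envelope of `N` is proportional to `x`. It cancels the `1 / x` in `herr`, so the error has
  -- constant amplitude.
  have hw : ∀ x, 1 - 2 * δ * (A - x / h) + δ ^ 2 = 4 * x / (a * (s + 1) ^ 2) := by
    intro x
    have e : 2 * δ * A = δ ^ 2 + 1 := by rw [hA]; field_simp
    have e2 : δ / h = 2 / (a * (s + 1) ^ 2) := by
      have : s ^ 2 - 1 ≠ 0 := by nlinarith
      have e2 : (s - 1) = δ * (s + 1) := by rw [hδ]; field_simp
      rw [hhdef]
      field_simp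
      linear_combination -(s + 1) * e2
    have e3 : 4 * x / (a * (s + 1) ^ 2) = 2 * x * (2 / (a * (s + 1) ^ 2)) := by ring
    rw [e3, ← e2]
    linear_combination -e
  have hone : A - a / h = 1 := by
    have : s ^ 2 - 1 ≠ 0 := by nlinarith
    rw [hAs, hhdef]; field_simp; ring
  have hmone : A - b / h = -1 := by
    have : s ^ 2 - 1 ≠ 0 := by nlinarith
    rw [hAs, hhdef, hb]; field_simp; ring
  have herr : ∀ x, 0 < x → 1 / x - M.divX.eval x = N.eval (A - x / h) / N.eval A / x := by
    intro x hx
    rw [← hp]; field_simp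
  refine ⟨M.divX, ?_, ?_, ?_, ?_⟩
  · rw [natDegree_divX_eq_natDegree_tsub_one]; omega
  · intro x hx
    have hx0 : 0 < x := ha.trans_le hx.1
    have ht : A - x / h ∈ Set.Icc (-1) 1 := by
      rw [← hmone, ← hone]
      exact ⟨by have := hx.2; gcongr, by have := hx.1; gcongr⟩
    have := abs_eval_errorNumerator_le hδ0 hδ1 n ht
    rw [hw] at this
    rw [herr x hx0, abs_div, abs_div, abs_of_pos hNpos, abs_of_pos hx0, div_div,
      div_le_iff₀ (by positivity), hEN]
    refine this.trans (le_of_eq ?_)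
    field_simp
  · obtain ⟨t, ht, ht'⟩ := exists_alternation_errorNumerator hδ0 hδ1 n
    refine ⟨fun i => h * (A - t i), fun i j hij hj => ?_, fun i hi => ?_⟩
    · have := ht i j hij hj
      simp only
      gcongr
    · obtain ⟨⟨hl, hr⟩, he⟩ := ht' i hi
      have hx : A - h * (A - t i) / h = t i := by field_simp; ring
      have ha' : a = h * (A - 1) := by rw [← hone]; field_simp; ring
      have hb' : b = h * (A - -1) := by rw [← hmone]; field_simp; ring
      have hm : h * (A - t i) ∈ Set.Icc a b := by
        rw [ha', hb']; constructor <;> gcongr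
      have hx0 : 0 < h * (A - t i) := ha.trans_le hm.1
      refine ⟨hm, ?_⟩
      simp only
      rw [herr _ hx0, hx, he, hEN]
      have := hw (h * (A - t i))
      rw [hx] at this
      rw [this]
      have hne := hx0.ne'
      generalize h * (A - t i) = z at hne
      field_simp
  · intro x hx
    have hA1 : 0 < A - 1 := by
      have : A - 1 = a / h := by linarith
      rw [this]; positivity
    have ht : A - x / h ∈ Set.Icc 1 A := by
      have h1 : x / h ≤ a / h := by have := hx.2; gcongr
      have h2 : 0 ≤ x / h := div_nonneg hx.1 hh.le
      constructor <;> linarith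
    have hc := chordBounded_errorNumerator A hδ1 n
    rw [hp]
    refine ⟨div_nonneg (hc.nonneg _ ht) hNpos.le, ?_⟩
    -- At `x = a`, that is `t = 1`, the residual is exactly `a E`, and it is `1` at `x = 0`; the
    -- chord joins these two values.
    have h1 : N.eval 1 / N.eval A = a * E := by
      have e2 : N.eval 1 = 4 * a / (a * (s + 1) ^ 2) := by
        rw [← hw a, hone, hN, eval_errorNumerator]
        simp only [Chebyshev.T_eval_one]
        ring
      rw [e2, hEN]; field_simp
    have hch := hc.chord _ ht
    rw [← h1, div_le_iff₀ hNpos]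
    have e1 : A - 1 = a / h := by linarith
    have e2 : A - (A - x / h) = x / h := by ring
    have e3 : A - x / h - 1 = a / h - x / h := by linarith
    rw [e1, e2, e3] at hch
    have e4 : (1 - x / a * (1 - N.eval 1 / N.eval A)) * N.eval A =
        (h / a) * (x / h * N.eval 1 + (a / h - x / h) * N.eval A) := by field_simp; ring
    rw [e4]
    calc N.eval (A - x / h) = (h / a) * (a / h * N.eval (A - x / h)) := by field_simp
      _ ≤ _ := mul_le_mul_of_nonneg_left hch (by positivity)

/-- The best uniform approximation to `1 / x` on `[a, b]`: its error, and its behaviour on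
`[0, a]`. -/
theorem IsBestRecipApprox.spec {a b : ℝ} (ha : 0 < a) (hab : a < b) {m : ℕ} (hm : 1 ≤ m)
    {q : ℝ[X]} (hq : IsBestRecipApprox a b m q) :
    (∀ x ∈ Set.Icc a b, |1 / x - q.eval x| ≤ optimalError a b m) ∧
      ∀ x ∈ Set.Icc 0 a, 0 ≤ 1 - x * q.eval x ∧
        1 - x * q.eval x ≤ 1 - x / a * (1 - a * optimalError a b m) := by
  obtain ⟨n, rfl⟩ : ∃ n, m = n + 1 := ⟨m - 1, by omega⟩
  obtain ⟨p, hpdeg, hperr, ⟨y, hy, hy'⟩, hp0⟩ := exists_alternating_recipApprox ha hab n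
  have hqerr : ∀ x ∈ Set.Icc a b, |1 / x - q.eval x| ≤ optimalError a b (n + 1) := fun x hx =>
    (abs_sub_le_recipError ha q hx).trans ((hq.2 p hpdeg).trans (recipError_le hab.le hperr))
  -- At the alternation points the error of `p` has the extreme values `±E`, and that of `q` is no
  -- larger, so `q - p` weakly alternates at `m + 2` points.
  have hz : q - p = 0 := by
    refine eq_zero_of_alternating (n := n + 1) hy
      ((natDegree_sub_le _ _).trans (max_le hq.1 hpdeg)) fun i hi => ?_
    obtain ⟨hm, he⟩ := hy' i hi
    have h1 := abs_le.1 (hqerr _ hm)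
    have h2 : q.eval (y i) - p.eval (y i) =
        (-1) ^ i * optimalError a b (n + 1) - (1 / y i - q.eval (y i)) := by rw [← he]; ring
    rw [eval_sub, h2]
    rcases neg_one_pow_eq_or ℝ i with h | h <;> rw [h] <;> linarith [h1.1, h1.2]
  rw [sub_eq_zero] at hz
  subst hz
  exact ⟨hperr, hp0⟩

end TwoLevel

namespace TwoLevel

/-! ### The symbol of the smoother -/

/-- The second entry of the maximum in `degreeBound` gives `δ^m ≤ 2 / (b (κ - 1))`. Hence the
product is at most `1 / b`, and `b ≥ 2` is needed for `1 / 2`. -/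
theorem mul_optimalError_le {ρ a b : ℝ} (ha : 0 < a) (hab : a < b) (hb : 2 ≤ b) {m : ℕ}
    (hm : degreeBound ρ a b ≤ m) : b * optimalError a b m ≤ 1 / 2 := by
  have hκ1 : 1 < b / a := by rwa [one_lt_div ha]
  have hs1 : 1 < √(b / a) := by rwa [Real.lt_sqrt zero_le_one, one_pow]
  simp only [degreeBound] at hm
  rw [optimalError]
  set κ := b / a
  set δ := (√κ - 1) / (√κ + 1) with hδ
  have hδ0 : 0 < δ := div_pos (by linarith) (by linarith)
  have hδ1 : δ < 1 := by rw [hδ, div_lt_one (by linarith)]; linarith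
  have hlog : Real.log δ < 0 := Real.log_neg hδ0 hδ1
  have hb0 : 0 < b := by linarith
  have hpos : 0 < 2 / (b * (κ - 1)) := by
    have : 0 < κ - 1 := by linarith
    positivity
  have h1 : |Real.log (2 / (b * (κ - 1)))| ≤ m * |Real.log δ| := by
    rw [one_div_mul_eq_div, div_le_iff₀ (abs_pos.2 hlog.ne)] at hm
    exact (le_max_right _ _).trans hm
  have h2 : δ ^ m ≤ 2 / (b * (κ - 1)) := by
    rw [← Real.log_le_log_iff (by positivity) hpos, Real.log_pow]
    rw [abs_of_neg hlog] at h1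
    linarith [neg_abs_le (Real.log (2 / (b * (κ - 1))))]
  calc b * ((κ - 1) * δ ^ m / (2 * b)) = (κ - 1) / 2 * δ ^ m := by field_simp
    _ ≤ (κ - 1) / 2 * (2 / (b * (κ - 1))) := by
        have : 0 ≤ (κ - 1) / 2 := by linarith
        gcongr
    _ = 1 / b := by
        have : κ - 1 ≠ 0 := by linarith
        field_simp
    _ ≤ 1 / 2 := by gcongr

/-- The bounds on the smoother and its symmetrization, as functions on the spectrum. -/
theorem IsBestRecipApprox.symbol_bounds {ρ a b : ℝ} (ha : 0 < a) (hab : a < b) (hb : 2 ≤ b) {m : ℕ}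
    (hm1 : 1 ≤ m) (hm : degreeBound ρ a b ≤ m) {q : ℝ[X]} (hq : IsBestRecipApprox a b m q)
    {x : ℝ} (hx0 : 0 < x) (hxb : x ≤ b) :
    0 < q.eval x * (2 - x * q.eval x) ∧ ∀ v e : ℝ,
      (x * q.eval x * v + (1 - x * q.eval x) * e) ^ 2 ≤
        q.eval x * (2 - x * q.eval x) * (6 * x * v ^ 2 + (4 * a + 6 * x) * e ^ 2) := by
  have hE := mul_optimalError_le ha hab hb hm
  obtain ⟨h1, h2⟩ := hq.spec ha hab hm1
  have hE0 : 0 ≤ optimalError a b m := (abs_nonneg _).trans (h1 a ⟨le_rfl, hab.le⟩)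
  obtain ⟨t, ht⟩ : ∃ t, t = x * q.eval x := ⟨_, rfl⟩
  have hqt : q.eval x = t / x := by rw [ht]; field_simp
  rw [← ht]
  have hsq : ∀ v e : ℝ, (t * v + (1 - t) * e) ^ 2 ≤ 2 * t ^ 2 * v ^ 2 + 2 * (1 - t) ^ 2 * e ^ 2 :=
    fun v e => by nlinarith [sq_nonneg (t * v - (1 - t) * e)]
  -- For `x ≥ a` the uniform error gives `|1 - t| ≤ 1 / 2`, so `t (2 - t) ≥ 3 / 4`. For `x ≤ a` the
  -- chord bound gives `x / (2a) ≤ t ≤ 1`, hence `q (2 - t) ≥ 1 / (2a)`, and the weight `4a` absorbs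
  -- `(1 - t)²`.
  rcases le_total a x with hax | hxa
  · have h3 : |1 - t| ≤ 1 / 2 := by
      have e : 1 - t = x * (1 / x - q.eval x) := by rw [ht]; field_simp
      rw [e, abs_mul, abs_of_pos hx0]
      calc x * |1 / x - q.eval x| ≤ b * optimalError a b m :=
            mul_le_mul hxb (h1 x ⟨hax, hxb⟩) (abs_nonneg _) (by linarith)
        _ ≤ 1 / 2 := hE
    obtain ⟨h4, h5⟩ := abs_le.1 h3
    have h6 : 3 / 4 ≤ t * (2 - t) := by nlinarith
    have hr : q.eval x * (2 - t) = t * (2 - t) / x := by rw [hqt]; ring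
    rw [hr]
    refine ⟨div_pos (by linarith) hx0, fun v e => (hsq v e).trans ?_⟩
    have h7 : t * (2 - t) / x * (6 * x * v ^ 2 + (4 * a + 6 * x) * e ^ 2) =
        6 * (t * (2 - t)) * v ^ 2 + 6 * (t * (2 - t)) * e ^ 2 +
          t * (2 - t) / x * (4 * a * e ^ 2) := by
      field_simp
      ring
    have h8 : 0 ≤ t * (2 - t) / x * (4 * a * e ^ 2) :=
      mul_nonneg (div_nonneg (by linarith) hx0.le) (by positivity)
    have h9 : 2 * t ^ 2 ≤ 6 * (t * (2 - t)) := by nlinarith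
    have h10 : 2 * (1 - t) ^ 2 ≤ 6 * (t * (2 - t)) := by nlinarith
    rw [h7]
    nlinarith [mul_le_mul_of_nonneg_right h9 (sq_nonneg v),
      mul_le_mul_of_nonneg_right h10 (sq_nonneg e)]
  · obtain ⟨h3, h4⟩ := h2 x ⟨hx0.le, hxa⟩
    rw [← ht] at h3 h4
    have haE : a * optimalError a b m ≤ 1 / 2 :=
      (mul_le_mul_of_nonneg_right hab.le hE0).trans hE
    have h5 : x / (2 * a) ≤ t := by
      have : x / a * (1 / 2) ≤ x / a * (1 - a * optimalError a b m) := by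
        have : 0 ≤ x / a := by positivity
        gcongr; linarith
      have e : x / (2 * a) = x / a * (1 / 2) := by ring
      linarith
    have h6 : 1 / (2 * a) ≤ q.eval x := by
      rw [hqt, le_div_iff₀ hx0]; rw [one_div_mul_eq_div]; exact h5
    have h7 : 0 < 1 / (2 * a) := by positivity
    have h8 : 1 / (2 * a) ≤ q.eval x * (2 - t) := by nlinarith
    have ht0 : 0 < t := by rw [ht]; exact mul_pos hx0 (by linarith)
    refine ⟨by linarith, fun v e => (hsq v e).trans ?_⟩
    have h9 : 2 * t ^ 2 ≤ q.eval x * (2 - t) * (6 * x) := by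
      have : q.eval x * (2 - t) * (6 * x) = 6 * (t * (2 - t)) := by rw [hqt]; field_simp
      rw [this]; nlinarith
    have h10 : 2 * (1 - t) ^ 2 ≤ q.eval x * (2 - t) * (4 * a + 6 * x) := by
      have h11 : 2 ≤ q.eval x * (2 - t) * (4 * a) := by
        have := mul_le_mul_of_nonneg_right h8 (by positivity : 0 ≤ 4 * a)
        have e : 1 / (2 * a) * (4 * a) = 2 := by field_simp; norm_num
        linarith
      have h12 : 0 ≤ q.eval x * (2 - t) * (6 * x) := by
        have : 0 ≤ q.eval x * (2 - t) := by linarith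
        positivity
      nlinarith
    nlinarith [mul_le_mul_of_nonneg_right h9 (sq_nonneg v),
      mul_le_mul_of_nonneg_right h10 (sq_nonneg e)]

/-! ### The degree of the smoother against the condition number -/

theorem one_div_sqrt_le_abs_log {κ : ℝ} (hκ : 1 < κ) :
    1 / √κ ≤ |Real.log ((√κ - 1) / (√κ + 1))| := by
  have hs1 : 1 < √κ := by rwa [Real.lt_sqrt zero_le_one, one_pow]
  have hδ0 : 0 < (√κ - 1) / (√κ + 1) := div_pos (by linarith) (by linarith)
  have h := Real.log_le_sub_one_of_pos hδ0
  refine le_trans ?_ (neg_le_abs _)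
  have e : 1 - (√κ - 1) / (√κ + 1) = 2 / (√κ + 1) := by field_simp; ring
  have h2 : 1 / √κ ≤ 2 / (√κ + 1) := by
    rw [div_le_div_iff₀ (by linarith) (by linarith)]; linarith
  linarith

/-- For `κ ≥ 2`, the maximum is `O(1 + log κ)` and `1 / |log δ| ≤ √κ`. As `κ → 1` the logarithms in
the maximum blow up, but so does `|log δ|`, and the quotient stays bounded. -/
theorem exists_degreeBound_le {ρ : ℝ} (hρ : 0 < ρ) (B : ℝ) : ∃ C : ℝ, 0 < C ∧ ∀ a b : ℝ,
    0 < a → a < b → 2 ≤ b → b ≤ B →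
      degreeBound ρ a b + 1 ≤ C * (√(b / a) * (1 + Real.log (b / a))) := by
  obtain ⟨D, hD⟩ : ∃ D, D = |Real.log (2 * ρ)| + |Real.log B| := ⟨_, rfl⟩
  have hD0 : 0 ≤ D := by rw [hD]; positivity
  refine ⟨D + 2, by linarith, fun a b ha hab hb hbB => ?_⟩
  have hκ1 : 1 < b / a := by rwa [one_lt_div ha]
  have hinv := one_div_sqrt_le_abs_log hκ1
  simp only [degreeBound]
  set κ := b / a
  have hs1 : 1 < √κ := by rwa [Real.lt_sqrt zero_le_one, one_pow]
  have hs2 : √κ ^ 2 = κ := Real.sq_sqrt (by linarith)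
  set s := √κ
  have hlogκ : 0 < Real.log κ := Real.log_pos hκ1
  have hb0 : 0 < b := by linarith
  have hκ0 : 0 < κ - 1 := by linarith
  have hmax : max |Real.log (2 * ρ / (κ - 1))| |Real.log (2 / (b * (κ - 1)))| ≤
      D + |Real.log (κ - 1)| := by
    refine max_le ?_ ?_
    · rw [Real.log_div (by positivity) hκ0.ne']
      have := abs_sub (Real.log (2 * ρ)) (Real.log (κ - 1))
      have h2 := abs_nonneg (Real.log B)
      linarith
    · rw [← div_div, Real.log_div (by positivity) hκ0.ne']
      have h1 := abs_sub (Real.log (2 / b)) (Real.log (κ - 1))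
      have h2 : |Real.log (2 / b)| ≤ |Real.log B| := by
        have h3 : Real.log (2 / b) ≤ 0 :=
          Real.log_nonpos (by positivity) (by rwa [div_le_one hb0])
        have h4 : Real.log b ≤ Real.log B := Real.log_le_log hb0 hbB
        have h5 : 0 < Real.log 2 := Real.log_pos (by norm_num)
        rw [abs_of_nonpos h3, Real.log_div (by norm_num) hb0.ne']
        linarith [le_abs_self (Real.log B)]
      have h3 := abs_nonneg (Real.log (2 * ρ))
      linarith
  have hδ0 : 0 < (s - 1) / (s + 1) := div_pos (by linarith) (by linarith)
  have hlpos : 0 < |Real.log ((s - 1) / (s + 1))| := lt_of_lt_of_le (by positivity) hinv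
  have hone : 1 ≤ s * (1 + Real.log κ) := by nlinarith
  rw [one_div_mul_eq_div]
  rcases le_or_gt 2 κ with hκ2 | hκ2
  · have h1 : |Real.log (κ - 1)| ≤ Real.log κ := by
      rw [abs_of_nonneg (Real.log_nonneg (by linarith))]
      exact Real.log_le_log hκ0 (by linarith)
    have h2 : max |Real.log (2 * ρ / (κ - 1))| |Real.log (2 / (b * (κ - 1)))| /
        |Real.log ((s - 1) / (s + 1))| ≤ (D + Real.log κ) * s := by
      rw [div_le_iff₀ hlpos]
      have h3 : 1 ≤ s * |Real.log ((s - 1) / (s + 1))| := by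
        rwa [div_le_iff₀' (by linarith)] at hinv
      have h4 : 0 ≤ D + Real.log κ := by linarith
      nlinarith [mul_le_mul_of_nonneg_left h3 h4]
    nlinarith [mul_nonneg hD0 hlogκ.le, mul_nonneg (mul_nonneg hD0 hlogκ.le) (by linarith : 0 ≤ s),
      mul_nonneg (by linarith : 0 ≤ s) hlogκ.le]
  · have h1 : |Real.log (κ - 1)| + 1 ≤ |Real.log ((s - 1) / (s + 1))| := by
      have h2 : Real.log (κ - 1) < 0 := Real.log_neg hκ0 (by linarith)
      -- `δ = (s² - 1) / (s + 1)²` and `s ≥ 1`. The factor `4` supplies the `+ 1` above, since `log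
      -- 4 ≥ 1`.
      have h3 : (s - 1) / (s + 1) ≤ (κ - 1) / 4 := by
        rw [div_le_div_iff₀ (by linarith) (by norm_num), ← hs2]
        nlinarith [mul_pos (by linarith : 0 < s - 1) (by linarith : 0 < s - 1),
          mul_pos (mul_pos (by linarith : 0 < s - 1) (by linarith : 0 < s - 1))
            (by linarith : 0 < s)]
      have h4 := Real.log_le_log hδ0 h3
      rw [Real.log_div hκ0.ne' (by norm_num)] at h4
      have h5 : 1 ≤ Real.log 4 := by
        rw [show (4 : ℝ) = 2 ^ 2 by norm_num, Real.log_pow]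
        have := Real.log_two_gt_d9
        push_cast
        linarith
      rw [abs_of_neg h2]
      linarith [neg_le_abs (Real.log ((s - 1) / (s + 1)))]
    have h2 : max |Real.log (2 * ρ / (κ - 1))| |Real.log (2 / (b * (κ - 1)))| /
        |Real.log ((s - 1) / (s + 1))| ≤ D + 1 := by
      rw [div_le_iff₀ hlpos]
      have h3 := abs_nonneg (Real.log (κ - 1))
      nlinarith [mul_le_mul_of_nonneg_left h1 (by linarith : 0 ≤ D + 1), mul_nonneg hD0 h3]
    nlinarith

theorem exists_le_log_sq_div_sq {ρ : ℝ} (hρ : 0 < ρ) {θ : ℝ} (hθ : 1 ≤ θ) (B : ℝ) :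
    ∃ C : ℝ, 0 < C ∧ ∀ (a b : ℝ) (m : ℕ), 0 < a → a < b → 2 ≤ b → b ≤ B → 2 ≤ m →
      (m : ℝ) ≤ θ * (degreeBound ρ a b + 1) → a ≤ C * (Real.log m ^ 2 / (m : ℝ) ^ 2) := by
  obtain ⟨C, hC, h⟩ := exists_degreeBound_le hρ B
  refine ⟨(2 + 4 * (θ * C)) ^ 2 * (|B| + 1), by positivity, fun a b m ha hab hb hbB hm hmθ => ?_⟩
  have hκ1 : 1 < b / a := by rwa [one_lt_div ha]
  have hs1 : 1 < √(b / a) := by rwa [Real.lt_sqrt zero_le_one, one_pow]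
  have hm2 : (2 : ℝ) ≤ m := by exact_mod_cast hm
  have hlogm : 1 / 2 ≤ Real.log m := by
    have := Real.log_le_log (by norm_num) hm2
    linarith [Real.log_two_gt_d9]
  have hθC : 0 < θ * C := by positivity
  -- `log κ` has to be exchanged for `log m`. If `m ≤ √κ`, then `2 log m ≥ 1` suffices. Otherwise
  -- `log κ ≤ 2 log m`, so `1 + log κ ≤ 4 log m`.
  have key : (m : ℝ) ≤ (2 + 4 * (θ * C)) * (√(b / a) * Real.log m) := by
    have hsl : 0 ≤ √(b / a) * Real.log m := by positivity
    rcases le_total (m : ℝ) √(b / a) with hms | hms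
    · nlinarith [mul_nonneg hθC.le hsl]
    · have h1 : Real.log (b / a) ≤ 2 * Real.log m := by
        have h2 : Real.log (b / a) = 2 * Real.log √(b / a) := by
          rw [Real.log_sqrt (by linarith)]; ring
        rw [h2]
        have := Real.log_le_log (by linarith) hms
        linarith
      calc (m : ℝ) ≤ θ * (C * (√(b / a) * (1 + Real.log (b / a)))) :=
            hmθ.trans (by have := h a b ha hab hb hbB; gcongr)
        _ ≤ θ * (C * (√(b / a) * (4 * Real.log m))) := by gcongr; linarith
        _ ≤ _ := by nlinarith
  have hsq : (m : ℝ) ^ 2 ≤ (2 + 4 * (θ * C)) ^ 2 * (b / a * Real.log m ^ 2) := by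
    calc (m : ℝ) ^ 2 ≤ ((2 + 4 * (θ * C)) * (√(b / a) * Real.log m)) ^ 2 := by gcongr
      _ = (2 + 4 * (θ * C)) ^ 2 * (√(b / a) ^ 2 * Real.log m ^ 2) := by ring
      _ = _ := by rw [Real.sq_sqrt (by linarith)]
  rw [← mul_div_assoc, le_div_iff₀ (by positivity)]
  calc a * (m : ℝ) ^ 2 ≤ a * ((2 + 4 * (θ * C)) ^ 2 * (b / a * Real.log m ^ 2)) := by gcongr
    _ = (2 + 4 * (θ * C)) ^ 2 * b * Real.log m ^ 2 := by field_simp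
    _ ≤ _ := by
      have : b ≤ |B| + 1 := by linarith [le_abs_self B]
      gcongr

end TwoLevel

namespace TwoLevel

universe u w

variable {V : Type u} {W : Type w} [Fintype V] [Fintype W]

/-! ### Quadratic forms -/

theorem dotProduct_mulVec_eq_transpose (M : Matrix V W ℝ) (x : V → ℝ) (y : W → ℝ) :
    x ⬝ᵥ (M *ᵥ y) = (Mᵀ *ᵥ x) ⬝ᵥ y := by
  rw [dotProduct_mulVec, mulVec_transpose]

theorem energySq_nonneg {A : Matrix V V ℝ} (hA : A.PosSemidef) (v : V → ℝ) :
    0 ≤ energySq A v := by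
  simpa [energySq] using hA.dotProduct_mulVec_nonneg v

theorem mulVec_eq_zero_of_energySq_eq_zero {A : Matrix V V ℝ} (hA : A.PosSemidef) {v : V → ℝ}
    (h : energySq A v = 0) : A *ᵥ v = 0 :=
  (hA.dotProduct_mulVec_zero_iff v).1 (by simpa [energySq] using h)

omit [Fintype V] in
theorem transpose_eq_of_posSemidef {A : Matrix V V ℝ} (hA : A.PosSemidef) : Aᵀ = A := by
  simpa using hA.isHermitian.eq

theorem energySq_sub {A : Matrix V V ℝ} (hA : Aᵀ = A) (x y : V → ℝ) :
    energySq A (x - y) = energySq A x - 2 * (x ⬝ᵥ (A *ᵥ y)) + energySq A y := by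
  have h : y ⬝ᵥ (A *ᵥ x) = x ⬝ᵥ (A *ᵥ y) := by
    rw [dotProduct_mulVec_eq_transpose, hA, dotProduct_comm]
  simp only [energySq, mulVec_sub, dotProduct_sub, sub_dotProduct, h]
  ring

theorem energySq_sub_le {A : Matrix V V ℝ} (hA : A.PosSemidef) (x y : V → ℝ) :
    energySq A (x - y) ≤ 2 * energySq A x + 2 * energySq A y := by
  have h1 := energySq_sub (transpose_eq_of_posSemidef hA) x y
  have h2 := energySq_sub (transpose_eq_of_posSemidef hA) x (-y)
  have h3 : energySq A (-y) = energySq A y := by simp [energySq, mulVec_neg]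
  rw [h3, mulVec_neg, dotProduct_neg] at h2
  linarith [energySq_nonneg hA (x - -y)]

/-- For symmetric `M` and `X` with `M X M = M`, the energy of `M v` with respect to `X` is the
energy of `v` with respect to `M`. -/
theorem energySq_mulVec {M X : Matrix V V ℝ} (hM : Mᵀ = M) (h : M * X * M = M) (v : V → ℝ) :
    energySq X (M *ᵥ v) = energySq M v := by
  have e : v ⬝ᵥ (M *ᵥ (X *ᵥ (M *ᵥ v))) = v ⬝ᵥ (M *ᵥ v) := by
    simp only [mulVec_mulVec]; rw [← Matrix.mul_assoc, h]
  rw [energySq, energySq, ← e, dotProduct_mulVec_eq_transpose M, hM]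

/-! ### The pseudo-inverse of a symmetric matrix -/

theorem IsMoorePenrose.transpose {M X : Matrix V V ℝ} (h : IsMoorePenrose M X) :
    IsMoorePenrose Mᵀ Xᵀ where
  mul_mul_left := by
    rw [← transpose_mul, ← transpose_mul, ← Matrix.mul_assoc, h.mul_mul_left]
  mul_mul_right := by
    rw [← transpose_mul, ← transpose_mul, ← Matrix.mul_assoc, h.mul_mul_right]
  symm_left := by rw [← transpose_mul, h.symm_right, h.symm_right]
  symm_right := by rw [← transpose_mul, h.symm_left, h.symm_left]

theorem pinv_transpose {M : Matrix V V ℝ} (hM : Mᵀ = M) : (pinv M)ᵀ = pinv M := by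
  have h := (pinv_spec M).transpose
  rw [hM] at h
  exact h.unique (pinv_spec M)

theorem mul_pinv_comm {M : Matrix V V ℝ} (hM : Mᵀ = M) : M * pinv M = pinv M * M := by
  rw [← (pinv_spec M).symm_left, transpose_mul, pinv_transpose hM, hM]

omit [Fintype W] in
theorem coarseMatrix_transpose {A : Matrix V V ℝ} (hA : Aᵀ = A) (P : Matrix V W ℝ) :
    (Pᵀ * A * P)ᵀ = Pᵀ * A * P := by
  simp only [transpose_mul, transpose_transpose, hA, Matrix.mul_assoc]

/-! ### The energy of the symmetrized preconditioner -/

section Preconditioner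

variable [DecidableEq V] {A R : Matrix V V ℝ} {P : Matrix V W ℝ}

/-- The projection `Π = A† A` is absorbed by any neighbouring `A†`, so it survives only at the two
ends. -/
theorem preconditioner_eq (hA : Aᵀ = A) (R : Matrix V V ℝ) (P : Matrix V W ℝ) :
    preconditioner A R P = pinv A -
      (pinv A * A) * errorProp A R P * pinv A * (errorProp A R P)ᵀ * (pinv A * A) := by
  have hY := pinv_spec A
  have hc := mul_pinv_comm hA
  have h1 : (pinv A * A) * pinv A = pinv A := hY.mul_mul_right
  have h2 : pinv A * (pinv A * A) = pinv A := by rw [← hc, ← Matrix.mul_assoc, h1]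
  simp only [preconditioner, energyAdjoint, onEnergySpace]
  generalize errorProp A R P = X
  rw [Matrix.sub_mul, Matrix.one_mul, transpose_mul (pinv A * A * X), transpose_mul (pinv A * A) X,
    hY.symm_right]
  congr 1
  calc pinv A * A * X * (pinv A * A) * (pinv A * (pinv A * A * (Xᵀ * (pinv A * A))) * A) * pinv A
      = pinv A * A * X * ((pinv A * A) * pinv A * (pinv A * A)) * Xᵀ *
          ((pinv A * A) * (A * pinv A)) := by simp only [Matrix.mul_assoc]
    _ = _ := by rw [h1, h2, hc, ← Matrix.mul_assoc (pinv A * A), h1]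

theorem preconditioner_transpose (hA : Aᵀ = A) (R : Matrix V V ℝ) (P : Matrix V W ℝ) :
    (preconditioner A R P)ᵀ = preconditioner A R P := by
  rw [preconditioner_eq hA]
  simp only [transpose_sub, transpose_mul, transpose_transpose, pinv_transpose hA,
    hA, mul_pinv_comm hA, Matrix.mul_assoc]

theorem preconditioner_mul_pinv_mul (hA : Aᵀ = A) (R : Matrix V V ℝ) (P : Matrix V W ℝ) :
    preconditioner A R P * (pinv A * A) = preconditioner A R P := by
  have h1 : (pinv A * A) * (pinv A * A) = pinv A * A := by
    rw [← Matrix.mul_assoc, (pinv_spec A).mul_mul_right]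
  have h2 : pinv A * (pinv A * A) = pinv A := by
    rw [← mul_pinv_comm hA, ← Matrix.mul_assoc, (pinv_spec A).mul_mul_right]
  rw [preconditioner_eq hA, Matrix.sub_mul, Matrix.mul_assoc _ (pinv A * A) (pinv A * A), h1, h2]

/-- The coarse space component `P A_H† Pᵀ y`. -/
def coarseSolve (A : Matrix V V ℝ) (P : Matrix V W ℝ) (y : V → ℝ) : V → ℝ :=
  P *ᵥ (pinv (Pᵀ * A * P) *ᵥ (Pᵀ *ᵥ y))

omit [DecidableEq V] in
theorem coarseSolve_dotProduct (hA : Aᵀ = A) (P : Matrix V W ℝ) (y : V → ℝ) :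
    energySq A (coarseSolve A P y) = y ⬝ᵥ coarseSolve A P y := by
  set H := pinv (Pᵀ * A * P) with hH
  have hHs : Hᵀ = H := pinv_transpose (coarseMatrix_transpose hA P)
  have h1 : energySq A (coarseSolve A P y) =
      (Pᵀ *ᵥ y) ⬝ᵥ ((H * (Pᵀ * A * P) * H) *ᵥ (Pᵀ *ᵥ y)) := by
    rw [energySq, coarseSolve, ← hH, dotProduct_comm, dotProduct_mulVec_eq_transpose,
      dotProduct_mulVec_eq_transpose, hHs, dotProduct_comm]
    simp only [mulVec_mulVec, Matrix.mul_assoc]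
  rw [h1, (pinv_spec (Pᵀ * A * P)).mul_mul_right, coarseSolve, dotProduct_mulVec_eq_transpose P]

-- Expand `0 ≤ |c - P z|_A²` for the coarse solution `c` of `y`. The hypothesis `hy` makes `y`
-- orthogonal to `ker A`, which identifies the cross term with `yᵀ P z` although `A_H` is singular
-- in general.
omit [DecidableEq V] in
theorem two_mul_dotProduct_mulVec_le (hA : A.PosSemidef) (P : Matrix V W ℝ) {y : V → ℝ}
    (hy : (pinv A * A) *ᵥ y = y) (z : W → ℝ) :
    2 * (y ⬝ᵥ (P *ᵥ z)) ≤ y ⬝ᵥ coarseSolve A P y + energySq A (P *ᵥ z) := by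
  have hAt := transpose_eq_of_posSemidef hA
  have hC := pinv_spec (Pᵀ * A * P)
  set H := pinv (Pᵀ * A * P) with hH
  have hHs : Hᵀ = H := pinv_transpose (coarseMatrix_transpose hAt P)
  -- `z₀` is the defect of `A_H† A_H` from the identity. It lies in `ker A_H`, so `P z₀` has zero
  -- energy and lies in `ker A`.
  obtain ⟨z₀, hz₀⟩ : ∃ z₀, z₀ = H *ᵥ ((Pᵀ * A * P) *ᵥ z) - z := ⟨_, rfl⟩
  have h0 : A *ᵥ (P *ᵥ z₀) = 0 := by
    refine mulVec_eq_zero_of_energySq_eq_zero hA ?_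
    have h1 : (Pᵀ * A * P) *ᵥ z₀ = 0 := by
      rw [hz₀, mulVec_sub, mulVec_mulVec, mulVec_mulVec, hC.mul_mul_left, sub_self]
    have h2 : energySq A (P *ᵥ z₀) = z₀ ⬝ᵥ ((Pᵀ * A * P) *ᵥ z₀) := by
      rw [energySq, dotProduct_comm, dotProduct_mulVec_eq_transpose, dotProduct_comm]
      simp only [mulVec_mulVec, Matrix.mul_assoc]
    rw [h2, h1, dotProduct_zero]
  have h1 : y ⬝ᵥ (P *ᵥ z₀) = 0 := by
    rw [← hy, ← (pinv_spec A).symm_right, ← dotProduct_mulVec_eq_transpose, ← mulVec_mulVec, h0,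
      mulVec_zero, dotProduct_zero]
  have h2 : coarseSolve A P y ⬝ᵥ (A *ᵥ (P *ᵥ z)) = y ⬝ᵥ (P *ᵥ z) := by
    have h3 : coarseSolve A P y ⬝ᵥ (A *ᵥ (P *ᵥ z)) =
        y ⬝ᵥ (P *ᵥ (H *ᵥ ((Pᵀ * A * P) *ᵥ z))) := by
      rw [coarseSolve, ← hH, dotProduct_comm, dotProduct_mulVec_eq_transpose,
        dotProduct_mulVec_eq_transpose, hHs, dotProduct_comm, dotProduct_mulVec_eq_transpose P]
      simp only [mulVec_mulVec, Matrix.mul_assoc]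
    have h4 : H *ᵥ ((Pᵀ * A * P) *ᵥ z) = z₀ + z := by rw [hz₀, sub_add_cancel]
    rw [h3, h4, mulVec_add, dotProduct_add, h1, zero_add]
  have h3 := energySq_nonneg hA (coarseSolve A P y - P *ᵥ z)
  rw [energySq_sub hAt, coarseSolve_dotProduct hAt, h2] at h3
  linarith

theorem energySq_preconditioner_eq_sub (hA : Aᵀ = A) (R : Matrix V V ℝ) (P : Matrix V W ℝ)
    (u : V → ℝ) : energySq (preconditioner A R P) u = energySq (pinv A) u -
      energySq (pinv A) ((errorProp A R P)ᵀ *ᵥ ((pinv A * A) *ᵥ u)) := by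
  rw [preconditioner_eq hA]
  simp only [energySq, sub_mulVec, dotProduct_sub]
  congr 1
  rw [← mulVec_mulVec, ← mulVec_mulVec, ← mulVec_mulVec, ← mulVec_mulVec,
    dotProduct_mulVec_eq_transpose, (pinv_spec A).symm_right,
    dotProduct_mulVec_eq_transpose (errorProp A R P)]

theorem pinv_mul_mulVec_smoothed (hA : Aᵀ = A) (hRA : R * A = A * R) (u : V → ℝ) :
    (pinv A * A) *ᵥ ((1 - R * A) *ᵥ ((pinv A * A) *ᵥ u)) =
      (1 - R * A) *ᵥ ((pinv A * A) *ᵥ u) := by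
  have e : (pinv A * A) * ((1 - R * A) * (pinv A * A)) = (1 - R * A) * (pinv A * A) := by
    have e1 : (pinv A * A) * (pinv A * A) = pinv A * A := by
      rw [← Matrix.mul_assoc, (pinv_spec A).mul_mul_right]
    have e2 : (pinv A * A) * (R * A) = R * A := by
      rw [hRA, ← Matrix.mul_assoc, ← mul_pinv_comm hA, (pinv_spec A).mul_mul_left]
    rw [Matrix.sub_mul, Matrix.one_mul, Matrix.mul_sub, e1, ← Matrix.mul_assoc _ (R * A), e2]
  rw [mulVec_mulVec u, mulVec_mulVec u, e]

/-- With `y = (1 - R A) A† A u`, the energy of the preconditioner is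
`uᵀ A† u - yᵀ A† y + yᵀ P A_H† Pᵀ y`. -/
theorem energySq_preconditioner (hA : Aᵀ = A) (hR : Rᵀ = R) (hRA : R * A = A * R)
    (P : Matrix V W ℝ) (u : V → ℝ) :
    energySq (preconditioner A R P) u = energySq (pinv A) u -
      energySq (pinv A) ((1 - R * A) *ᵥ ((pinv A * A) *ᵥ u)) +
      ((1 - R * A) *ᵥ ((pinv A * A) *ᵥ u)) ⬝ᵥ
        coarseSolve A P ((1 - R * A) *ᵥ ((pinv A * A) *ᵥ u)) := by
  have hY := pinv_spec A
  have hYt := pinv_transpose hA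
  have hc := mul_pinv_comm hA
  have hHs : (pinv (Pᵀ * A * P))ᵀ = pinv (Pᵀ * A * P) :=
    pinv_transpose (coarseMatrix_transpose hA P)
  set y := (1 - R * A) *ᵥ ((pinv A * A) *ᵥ u) with hy
  have hz : (errorProp A R P)ᵀ *ᵥ ((pinv A * A) *ᵥ u) = y - A *ᵥ coarseSolve A P y := by
    rw [errorProp, transpose_mul, ← mulVec_mulVec]
    have e1 : (1 - R * A)ᵀ = 1 - R * A := by
      rw [transpose_sub, transpose_one, transpose_mul, hA, hR, hRA]
    rw [e1, ← hy, coarseCorrection, coarseSolve]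
    simp only [transpose_sub, transpose_one, transpose_mul, transpose_transpose, hA, hHs,
      sub_mulVec, one_mulVec, mulVec_mulVec]
  have hYA : (pinv A * A) *ᵥ y = y := pinv_mul_mulVec_smoothed hA hRA u
  have h1 : energySq (preconditioner A R P) u = energySq (pinv A) u -
      energySq (pinv A) (y - A *ᵥ coarseSolve A P y) := by
    rw [← hz]; exact energySq_preconditioner_eq_sub hA R P u
  have h2 : energySq (pinv A) (A *ᵥ coarseSolve A P y) = y ⬝ᵥ coarseSolve A P y := by
    rw [← coarseSolve_dotProduct hA, energySq, energySq, mulVec_mulVec, dotProduct_comm,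
      dotProduct_mulVec_eq_transpose, hA, mulVec_mulVec, ← Matrix.mul_assoc, hY.mul_mul_left,
      dotProduct_comm]
  have h3 : y ⬝ᵥ (pinv A *ᵥ (A *ᵥ coarseSolve A P y)) = y ⬝ᵥ coarseSolve A P y := by
    rw [mulVec_mulVec, dotProduct_mulVec_eq_transpose, hY.symm_right, hYA]
  rw [h1, energySq_sub hYt, h2, h3]
  ring

end Preconditioner

/-! ### Functional calculus in an orthonormal eigenbasis -/

section Spectral

variable [DecidableEq V]

/-- The function `f` of the symmetric matrix with eigenvectors `U` and eigenvalues `d`. -/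
def spectralFun (U : Matrix V V ℝ) (d : V → ℝ) (f : ℝ → ℝ) : Matrix V V ℝ :=
  U * diagonal (fun i => f (d i)) * Uᵀ

theorem exists_eq_spectralFun {A : Matrix V V ℝ} (hA : A.PosSemidef) {b : ℝ}
    (hb : ∀ (x : ℝ) (v : V → ℝ), v ≠ 0 → A *ᵥ v = x • v → x ≤ b) :
    ∃ (U : Matrix V V ℝ) (d : V → ℝ), Uᵀ * U = 1 ∧ A = spectralFun U d id ∧
      ∀ i, 0 ≤ d i ∧ d i ≤ b := by
  have hS := hA.isHermitian
  refine ⟨hS.eigenvectorUnitary, hS.eigenvalues, ?_, ?_, fun i => ⟨hA.eigenvalues_nonneg i, ?_⟩⟩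
  · have := (Matrix.mem_unitaryGroup_iff').1 hS.eigenvectorUnitary.2
    simpa [Matrix.star_eq_conjTranspose] using this
  · have := hS.spectral_theorem
    simpa [spectralFun, Unitary.conjStarAlgAut_apply, Matrix.star_eq_conjTranspose,
      Function.comp_def] using this
  · refine hb _ _ ?_ (hS.mulVec_eigenvectorBasis i)
    intro h
    have h1 := hS.eigenvectorBasis.orthonormal.ne_zero i
    exact h1 (by ext j; exact congrFun h j)

variable {U : Matrix V V ℝ} (d : V → ℝ)

theorem spectralFun_mul (hU : Uᵀ * U = 1) (f g : ℝ → ℝ) :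
    spectralFun U d f * spectralFun U d g = spectralFun U d (fun x => f x * g x) := by
  unfold spectralFun
  calc (U * diagonal (fun i => f (d i)) * Uᵀ) * (U * diagonal (fun i => g (d i)) * Uᵀ)
      = U * diagonal (fun i => f (d i)) * (Uᵀ * U) * diagonal (fun i => g (d i)) * Uᵀ := by
        simp only [Matrix.mul_assoc]
    _ = U * (diagonal (fun i => f (d i)) * diagonal (fun i => g (d i))) * Uᵀ := by
        rw [hU, Matrix.mul_one]; simp only [Matrix.mul_assoc]
    _ = _ := by rw [diagonal_mul_diagonal]

theorem spectralFun_transpose (f : ℝ → ℝ) : (spectralFun U d f)ᵀ = spectralFun U d f := by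
  simp [spectralFun, Matrix.mul_assoc]

theorem spectralFun_one (hU : Uᵀ * U = 1) : spectralFun U d (fun _ => 1) = 1 := by
  have : U * Uᵀ = 1 := mul_eq_one_comm.1 hU
  simp [spectralFun, this]

theorem spectralFun_add (f g : ℝ → ℝ) :
    spectralFun U d f + spectralFun U d g = spectralFun U d (fun x => f x + g x) := by
  simp only [spectralFun, ← Matrix.add_mul, ← Matrix.mul_add, diagonal_add]

theorem spectralFun_sub (f g : ℝ → ℝ) :
    spectralFun U d f - spectralFun U d g = spectralFun U d (fun x => f x - g x) := by
  simp only [spectralFun, ← Matrix.sub_mul, ← Matrix.mul_sub, diagonal_sub]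

theorem aeval_spectralFun (hU : Uᵀ * U = 1) (q : ℝ[X]) :
    aeval (spectralFun U d id) q = spectralFun U d (fun x => q.eval x) := by
  induction q using Polynomial.induction_on' with
  | add p q hp hq => rw [map_add, hp, hq, spectralFun_add]; simp
  | monomial n c =>
    have hpow : spectralFun U d id ^ n = spectralFun U d (fun x => x ^ n) := by
      induction n with
      | zero => simp [spectralFun_one d hU]
      | succ n ih => rw [pow_succ, ih, spectralFun_mul d hU]; simp [pow_succ]
    have hc : algebraMap ℝ (Matrix V V ℝ) c = spectralFun U d (fun _ => c) := by
      rw [Algebra.algebraMap_eq_smul_one, ← spectralFun_one d hU]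
      simp only [spectralFun]
      rw [← Matrix.smul_mul, ← Matrix.mul_smul, ← diagonal_smul]
      congr 3
      ext i; simp
    rw [aeval_monomial, hpow, hc, spectralFun_mul d hU]
    simp

theorem pinv_spectralFun (hU : Uᵀ * U = 1) :
    pinv (spectralFun U d id) = spectralFun U d (fun x => x⁻¹) := by
  refine (pinv_spec _).unique ⟨?_, ?_, ?_, ?_⟩
  · rw [spectralFun_mul d hU, spectralFun_mul d hU]; congr 1; ext x; simp
  · rw [spectralFun_mul d hU, spectralFun_mul d hU]; congr 1; ext x
    by_cases h : x = 0 <;> simp [h]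
  · rw [spectralFun_mul d hU, spectralFun_transpose]
  · rw [spectralFun_mul d hU, spectralFun_transpose]

theorem transpose_mulVec_spectralFun (hU : Uᵀ * U = 1) (f : ℝ → ℝ) (v : V → ℝ) (i : V) :
    (Uᵀ *ᵥ (spectralFun U d f *ᵥ v)) i = f (d i) * (Uᵀ *ᵥ v) i := by
  rw [spectralFun, mulVec_mulVec, ← Matrix.mul_assoc, ← Matrix.mul_assoc, hU, Matrix.one_mul,
    ← mulVec_mulVec, mulVec_diagonal]

theorem dotProduct_spectralFun (f : ℝ → ℝ) (v w : V → ℝ) :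
    v ⬝ᵥ (spectralFun U d f *ᵥ w) = ∑ i, f (d i) * (Uᵀ *ᵥ v) i * (Uᵀ *ᵥ w) i := by
  rw [spectralFun, ← mulVec_mulVec, ← mulVec_mulVec, dotProduct_mulVec_eq_transpose, dotProduct]
  refine Finset.sum_congr rfl fun i _ => ?_
  rw [mulVec_diagonal]; ring

end Spectral

end TwoLevel

namespace TwoLevel

universe u w

variable {V : Type u} {W : Type w} [Fintype V] [Fintype W] [DecidableEq V]

/-! ### Spectral equivalence from bounds on the symbol of the smoother -/

/-- The energy that the smoother alone contributes to the preconditioner. -/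
def smootherEnergy (A R : Matrix V V ℝ) (u : V → ℝ) : ℝ :=
  energySq (pinv A) u - energySq (pinv A) ((1 - R * A) *ᵥ ((pinv A * A) *ᵥ u))

section

variable {U : Matrix V V ℝ} (d : V → ℝ)

theorem energySq_spectralFun (f : ℝ → ℝ) (v : V → ℝ) :
    energySq (spectralFun U d f) v = ∑ i, f (d i) * (Uᵀ *ᵥ v) i ^ 2 := by
  rw [energySq, dotProduct_spectralFun]
  exact Finset.sum_congr rfl fun i _ => by ring

variable (hU : Uᵀ * U = 1) (q : ℝ[X])
include hU

theorem pinv_mul_spectralFun : pinv (spectralFun U d id) * spectralFun U d id =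
    spectralFun U d (fun x => x⁻¹ * x) := by
  rw [pinv_spectralFun d hU, spectralFun_mul d hU]; rfl

theorem one_sub_aeval_mul_spectralFun :
    1 - aeval (spectralFun U d id) q * spectralFun U d id =
      spectralFun U d (fun x => 1 - x * q.eval x) := by
  rw [aeval_spectralFun d hU, spectralFun_mul d hU, ← spectralFun_one d hU, spectralFun_sub]
  congr 1; ext x; simp [mul_comm]

theorem normSq_eq_sum (v : V → ℝ) : normSq v = ∑ i, (Uᵀ *ᵥ v) i ^ 2 := by
  have h := dotProduct_spectralFun (U := U) 0 (fun _ => 1) v v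
  rw [spectralFun_one 0 hU, one_mulVec] at h
  rw [normSq, h]
  exact Finset.sum_congr rfl fun i _ => by ring

/-- With `t = x q(x)`, `(1 - (1 - t)²) / x = q (2 - t)`. The factor `(d i)⁻¹ * d i` is the indicator
of nonzero eigenvalues. -/
theorem smootherEnergy_spectralFun (u : V → ℝ) :
    smootherEnergy (spectralFun U d id) (aeval (spectralFun U d id) q) u =
      ∑ i, ((d i)⁻¹ * d i) * (q.eval (d i) * (2 - d i * q.eval (d i))) * (Uᵀ *ᵥ u) i ^ 2 := by
  rw [smootherEnergy, one_sub_aeval_mul_spectralFun d hU, pinv_mul_spectralFun d hU,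
    pinv_spectralFun d hU, energySq_spectralFun d, energySq_spectralFun d,
    ← Finset.sum_sub_distrib]
  refine Finset.sum_congr rfl fun i _ => ?_
  rw [transpose_mulVec_spectralFun d hU, transpose_mulVec_spectralFun d hU]
  by_cases h : d i = 0
  · simp [h]
  · field_simp; ring

end

variable {A : Matrix V V ℝ} {a b : ℝ} {q : ℝ[X]}

theorem aeval_transpose (hA : A.PosSemidef)
    (hb : ∀ (x : ℝ) (v : V → ℝ), v ≠ 0 → A *ᵥ v = x • v → x ≤ b) (q : ℝ[X]) : (aeval A q)ᵀ = aeval A q := by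
  obtain ⟨U, d, hU, hAd, _⟩ := exists_eq_spectralFun hA hb
  rw [hAd, aeval_spectralFun d hU, spectralFun_transpose]

theorem aeval_mul_comm (A : Matrix V V ℝ) (q : ℝ[X]) : aeval A q * A = A * aeval A q := by
  have h := congrArg (aeval A) (mul_comm q X)
  simpa using h

theorem smootherEnergy_nonneg (hA : A.PosSemidef)
    (hb : ∀ (x : ℝ) (v : V → ℝ), v ≠ 0 → A *ᵥ v = x • v → x ≤ b)
    (hq : ∀ x, 0 < x → x ≤ b → 0 < q.eval x * (2 - x * q.eval x)) (u : V → ℝ) :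
    0 ≤ smootherEnergy A (aeval A q) u ∧
      (smootherEnergy A (aeval A q) u = 0 → A *ᵥ u = 0) := by
  obtain ⟨U, d, hU, hAd, hd⟩ := exists_eq_spectralFun hA hb
  have hterm : ∀ i ∈ Finset.univ,
      0 ≤ ((d i)⁻¹ * d i) * (q.eval (d i) * (2 - d i * q.eval (d i))) * (Uᵀ *ᵥ u) i ^ 2 := by
    intro i _
    rcases (hd i).1.eq_or_lt with h | h
    · simp [← h]
    · have := hq _ h (hd i).2
      positivity
  subst hAd
  refine ⟨by
    rw [smootherEnergy_spectralFun d hU]; exact Finset.sum_nonneg hterm, fun h => ?_⟩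
  rw [smootherEnergy_spectralFun d hU, Finset.sum_eq_zero_iff_of_nonneg hterm] at h
  refine mulVec_eq_zero_of_energySq_eq_zero hA ?_
  rw [energySq_spectralFun d]
  refine Finset.sum_eq_zero fun i hi => ?_
  rcases (hd i).1.eq_or_lt with h0 | h0
  · simp [← h0]
  · have h1 := hq _ h0 (hd i).2
    have h2 := h i hi
    rw [inv_mul_cancel₀ h0.ne', one_mul, mul_eq_zero] at h2
    rw [h2.resolve_left h1.ne', mul_zero]

/-- The Cauchy-Schwarz estimate for the fine component of the decomposition
`v = (R A v + (1 - R A) (v - s)) + (1 - R A) s`. -/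
theorem two_mul_dotProduct_sub_le (hA : A.PosSemidef) (ha : 0 ≤ a)
    (hb : ∀ (x : ℝ) (v : V → ℝ), v ≠ 0 → A *ᵥ v = x • v → x ≤ b)
    (hq : ∀ x, 0 < x → x ≤ b → 0 < q.eval x * (2 - x * q.eval x) ∧ ∀ v e : ℝ,
      (x * q.eval x * v + (1 - x * q.eval x) * e) ^ 2 ≤
        q.eval x * (2 - x * q.eval x) * (6 * x * v ^ 2 + (4 * a + 6 * x) * e ^ 2))
    (u v s : V → ℝ) :
    2 * (u ⬝ᵥ ((pinv A * A) *ᵥ v)) -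
        2 * (((1 - aeval A q * A) *ᵥ ((pinv A * A) *ᵥ u)) ⬝ᵥ s) ≤
      smootherEnergy A (aeval A q) u +
        (6 * energySq A v + 4 * a * normSq (v - s) + 6 * energySq A (v - s)) := by
  obtain ⟨U, d, hU, hAd, hd⟩ := exists_eq_spectralFun hA hb
  have hdot : ((1 - aeval A q * A) *ᵥ ((pinv A * A) *ᵥ u)) ⬝ᵥ s =
      ∑ i, ((1 - d i * q.eval (d i)) * ((d i)⁻¹ * d i)) * (Uᵀ *ᵥ u) i * (Uᵀ *ᵥ s) i := by
    rw [hAd, one_sub_aeval_mul_spectralFun d hU, pinv_mul_spectralFun d hU, mulVec_mulVec,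
      spectralFun_mul d hU, ← spectralFun_transpose, ← dotProduct_mulVec_eq_transpose,
      dotProduct_spectralFun]
  subst hAd
  rw [hdot, smootherEnergy_spectralFun d hU, normSq_eq_sum hU, pinv_mul_spectralFun d hU, dotProduct_spectralFun,
    energySq_spectralFun d, energySq_spectralFun d]
  simp only [Finset.mul_sum, ← Finset.sum_sub_distrib, ← Finset.sum_add_distrib]
  refine Finset.sum_le_sum fun i _ => ?_
  have he : (Uᵀ *ᵥ (v - s)) i = (Uᵀ *ᵥ v) i - (Uᵀ *ᵥ s) i := by rw [mulVec_sub]; rfl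
  rw [he]
  generalize (Uᵀ *ᵥ u) i = û
  generalize (Uᵀ *ᵥ v) i = v'
  generalize (Uᵀ *ᵥ s) i = s'
  simp only [id]
  rcases (hd i).1.eq_or_lt with h0 | h0
  · rw [← h0]; simp; positivity
  · obtain ⟨h1, h2⟩ := hq _ h0 (hd i).2
    have h3 := h2 v' (v' - s')
    rw [inv_mul_cancel₀ h0.ne', mul_one, one_mul]
    set r := q.eval (d i) * (2 - d i * q.eval (d i))
    set S := 6 * d i * v' ^ 2 + (4 * a + 6 * d i) * (v' - s') ^ 2
    set t := d i * q.eval (d i)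
    -- Young's inequality from `w² ≤ r S`: `r (r û² + S - 2 û w) ≥ (r û - w)² ≥ 0`, divided by `r >
    -- 0`.
    have h4 : 2 * û * (t * v' + (1 - t) * (v' - s')) ≤ r * û ^ 2 + S := by
      set w := t * v' + (1 - t) * (v' - s')
      have h5 : 0 ≤ (r * û - w) ^ 2 := sq_nonneg _
      have h6 : 0 ≤ r * (r * û ^ 2 + S - 2 * û * w) := by nlinarith
      have := nonneg_of_mul_nonneg_right h6 h1
      linarith
    simp only [S] at h4
    linarith

/-- Lower bound: expand `0 ≤ |v - B A v|²` in the `B†` energy and use `B ≤ A†`. Upper bound: test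
with `u = B† v`, for which `uᵀ v` and `uᵀ B u` both equal `vᵀ B† v`, and add the fine and coarse
estimates. The coarse energy `|P z|_A²` costs the extra `2` that turns each `6` into `8`. -/
theorem spectralEquivalence_of_symbol_bounds (hA : A.PosSemidef) (ha : 0 ≤ a)
    (hb : ∀ (x : ℝ) (v : V → ℝ), v ≠ 0 → A *ᵥ v = x • v → x ≤ b)
    (hq : ∀ x, 0 < x → x ≤ b → 0 < q.eval x * (2 - x * q.eval x) ∧ ∀ v e : ℝ,
      (x * q.eval x * v + (1 - x * q.eval x) * e) ^ 2 ≤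
        q.eval x * (2 - x * q.eval x) * (6 * x * v ^ 2 + (4 * a + 6 * x) * e ^ 2))
    (P : Matrix V W ℝ) (v : V → ℝ) (z : W → ℝ) :
    energySq A v ≤ energySq (pinv (preconditioner A (aeval A q) P)) v ∧
      energySq (pinv (preconditioner A (aeval A q) P)) v ≤
        8 * energySq A v + 4 * a * normSq (v - P *ᵥ z) + 8 * energySq A (v - P *ᵥ z) := by
  have hAt := transpose_eq_of_posSemidef hA
  have hRt := aeval_transpose hA hb q
  have hRA := aeval_mul_comm A q
  have hY := pinv_spec A
  have hBt := preconditioner_transpose hAt (aeval A q) P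
  have hBproj := preconditioner_mul_pinv_mul hAt (aeval A q) P
  have hBen : ∀ u, energySq (preconditioner A (aeval A q) P) u = smootherEnergy A (aeval A q) u +
      ((1 - aeval A q * A) *ᵥ ((pinv A * A) *ᵥ u)) ⬝ᵥ
        coarseSolve A P ((1 - aeval A q * A) *ᵥ ((pinv A * A) *ᵥ u)) := fun u =>
    energySq_preconditioner hAt hRt hRA P u
  have hcoarse : ∀ y, 0 ≤ y ⬝ᵥ coarseSolve A P y := fun y => by
    rw [← coarseSolve_dotProduct hAt]; exact energySq_nonneg hA _
  have hsm := smootherEnergy_nonneg hA hb (fun x h0 h1 => (hq x h0 h1).1)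
  have hBA : ∀ u, preconditioner A (aeval A q) P *ᵥ u = 0 → A *ᵥ u = 0 := by
    intro u hu
    have h1 : energySq (preconditioner A (aeval A q) P) u = 0 := by
      rw [energySq, hu, dotProduct_zero]
    rw [hBen] at h1
    have h2 := hcoarse ((1 - aeval A q * A) *ᵥ ((pinv A * A) *ᵥ u))
    exact (hsm u).2 (by linarith [(hsm u).1])
  have hBnn : ∀ u, 0 ≤ energySq (preconditioner A (aeval A q) P) u := fun u => by
    rw [hBen]; exact add_nonneg (hsm u).1 (hcoarse _)
  have hABA : ∀ v, energySq (preconditioner A (aeval A q) P) (A *ᵥ v) ≤ energySq A v := by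
    intro v
    have hYt := pinv_transpose hAt
    rw [energySq_preconditioner_eq_sub hAt, energySq_mulVec hAt hY.mul_mul_left,
      ← energySq_mulVec hYt hY.mul_mul_right]
    linarith [energySq_nonneg hA (pinv A *ᵥ
      ((errorProp A (aeval A q) P)ᵀ *ᵥ ((pinv A * A) *ᵥ (A *ᵥ v))))]
  set B := preconditioner A (aeval A q) P
  have hX := pinv_spec B
  have hXt := pinv_transpose hBt
  have hXB := mul_pinv_comm hBt
  set X := pinv B
  have hXen : ∀ v, energySq B (X *ᵥ v) = energySq X v :=
    fun v => energySq_mulVec hXt hX.mul_mul_right v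
  constructor
  -- `ker B ⊆ ker A`, by positivity of the smoother energy, so `A` does not see the part of a vector
  -- removed by the projection `B† B`.
  · have hAXB : A * (X * B) = A := by
      refine Matrix.toLin'.injective (LinearMap.ext fun x => ?_)
      rw [toLin'_apply, toLin'_apply]
      have h1 : B *ᵥ ((X * B) *ᵥ x - x) = 0 := by
        rw [mulVec_sub, mulVec_mulVec, ← Matrix.mul_assoc, hX.mul_mul_left, sub_self]
      have h2 := hBA _ h1
      rwa [mulVec_sub, mulVec_mulVec, sub_eq_zero] at h2
    have hXBA : X * B * A = A := by
      have := congrArg transpose hAXB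
      rwa [transpose_mul, hX.symm_right, hAt] at this
    have h0 : 0 ≤ energySq X (v - B *ᵥ (A *ᵥ v)) := by rw [← hXen]; exact hBnn _
    have h1 : v ⬝ᵥ (X *ᵥ (B *ᵥ (A *ᵥ v))) = energySq A v := by
      rw [energySq]; simp only [mulVec_mulVec]; rw [← Matrix.mul_assoc, hXBA]
    have h2 : energySq X (B *ᵥ (A *ᵥ v)) = energySq B (A *ᵥ v) :=
      energySq_mulVec hBt hX.mul_mul_left _
    rw [energySq_sub hXt, h1, h2] at h0
    linarith [hABA v]
  -- The range of `B†` is that of `B`, which lies in `(ker A)ᗮ`.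
  · have hprojX : (pinv A * A) * X = X := by
      have h1 : (pinv A * A) * B = B := by
        have := congrArg transpose hBproj
        rwa [transpose_mul, hY.symm_right, hBt] at this
      calc (pinv A * A) * X = (pinv A * A) * (X * B * X) := by rw [hX.mul_mul_right]
        _ = (pinv A * A) * B * (X * X) := by rw [← hXB]; simp only [Matrix.mul_assoc]
        _ = B * X * X := by rw [h1, Matrix.mul_assoc]
        _ = X := by rw [hXB, hX.mul_mul_right]
    set u := X *ᵥ v with hu
    have h1 : u ⬝ᵥ ((pinv A * A) *ᵥ v) = energySq X v := by
      rw [dotProduct_mulVec_eq_transpose, hY.symm_right, hu, mulVec_mulVec, hprojX, dotProduct_comm,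
        energySq]
    have hproj : (pinv A * A) *ᵥ ((1 - aeval A q * A) *ᵥ ((pinv A * A) *ᵥ u)) =
        (1 - aeval A q * A) *ᵥ ((pinv A * A) *ᵥ u) :=
      pinv_mul_mulVec_smoothed hAt hRA u
    have h2 := two_mul_dotProduct_mulVec_le hA P hproj z
    have h3 := two_mul_dotProduct_sub_le hA ha hb hq u v (P *ᵥ z)
    have h4 := hXen v
    rw [← hu, hBen] at h4
    have h5 : energySq A (P *ᵥ z) ≤ 2 * energySq A v + 2 * energySq A (v - P *ᵥ z) := by
      have := energySq_sub_le hA v (v - P *ᵥ z)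
      rwa [sub_sub_cancel] at this
    linarith

end TwoLevel

namespace TwoLevel

universe u w

variable {V : Type u} {W : Type w} [Fintype V]

theorem normSq_pos {v : V → ℝ} (hv : v ≠ 0) : 0 < normSq v := by
  have h := dotProduct_self_eq_zero (v := v)
  have h0 : 0 ≤ normSq v := Finset.sum_nonneg fun i _ => mul_self_nonneg (v i)
  exact lt_of_le_of_ne h0 fun h' => hv (h.1 h'.symm)

/-! ### The maximum norm of the graph Laplacian -/

theorem sum_abs_le_linftyNorm (M : Matrix V V ℝ) (i : V) : ∑ j, |M i j| ≤ linftyNorm M := by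
  have h : linftyNorm M = ((Finset.univ.sup fun i : V => ∑ j, ‖M i j‖₊ : NNReal) : ℝ) :=
    Matrix.linfty_opNorm_def M
  rw [h]
  have h2 := Finset.le_sup (f := fun i : V => ∑ j, ‖M i j‖₊) (Finset.mem_univ i)
  have h3 := NNReal.coe_le_coe.2 h2
  simpa [NNReal.coe_sum] using h3

theorem linftyNorm_le {M : Matrix V V ℝ} {c : ℝ} (hc : 0 ≤ c) (h : ∀ i, ∑ j, |M i j| ≤ c) :
    linftyNorm M ≤ c := by
  have h' : linftyNorm M = ((Finset.univ.sup fun i : V => ∑ j, ‖M i j‖₊ : NNReal) : ℝ) :=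
    Matrix.linfty_opNorm_def M
  rw [h', ← NNReal.coe_mk c hc, NNReal.coe_le_coe]
  refine Finset.sup_le fun i _ => ?_
  rw [← NNReal.coe_le_coe]
  simpa [NNReal.coe_sum] using h i

theorem eigenvalue_le_linftyNorm {M : Matrix V V ℝ} {x : ℝ} {v : V → ℝ} (hv : v ≠ 0)
    (h : M *ᵥ v = x • v) : x ≤ linftyNorm M := by
  let : NormedAddCommGroup (Matrix V V ℝ) := Matrix.linftyOpNormedAddCommGroup
  have h1 : ‖M *ᵥ v‖ ≤ linftyNorm M * ‖v‖ := Matrix.linfty_opNorm_mulVec M v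
  rw [h, norm_smul] at h1
  exact (le_abs_self x).trans (le_of_mul_le_mul_right h1 (norm_pos_iff.2 hv))

section Laplacian

variable [DecidableEq V] (G : SimpleGraph V) [DecidableRel G.Adj]

theorem sum_abs_lapMatrix (i : V) : ∑ j, |G.lapMatrix ℝ i j| = 2 * G.degree i := by
  have h : ∀ j, |G.lapMatrix ℝ i j| =
      (if i = j then (G.degree i : ℝ) else 0) + if G.Adj i j then 1 else 0 := by
    intro j
    by_cases hij : i = j
    · subst hij; simp [SimpleGraph.lapMatrix, SimpleGraph.degMatrix]
    · by_cases ha : G.Adj i j <;>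
        simp [SimpleGraph.lapMatrix, SimpleGraph.degMatrix, hij, ha]
  simp only [h, Finset.sum_add_distrib, ← SimpleGraph.degree_eq_sum_if_adj]
  simp; ring

theorem degree_le_maxRowNonzeros (i : V) :
    G.degree i ≤ maxRowNonzeros (G.lapMatrix ℝ) := by
  refine le_trans ?_ (Finset.le_sup (f := fun i => {j | G.lapMatrix ℝ i j ≠ 0}.ncard)
    (Finset.mem_univ i))
  rw [← SimpleGraph.card_neighborFinset_eq_degree, ← Set.ncard_coe_finset]
  refine Set.ncard_le_ncard (fun j hj => ?_) (Set.toFinite _)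
  have ha : G.Adj i j := by simpa using hj
  simp [SimpleGraph.lapMatrix, SimpleGraph.degMatrix, ha.ne, ha]

theorem linftyNorm_lapMatrix_le :
    linftyNorm (G.lapMatrix ℝ) ≤ 2 * maxRowNonzeros (G.lapMatrix ℝ) := by
  refine linftyNorm_le (by positivity) fun i => ?_
  rw [sum_abs_lapMatrix]
  have := degree_le_maxRowNonzeros G i
  gcongr

/-- Absolute row sums are twice the degrees, and degrees are integers. -/
theorem two_le_linftyNorm_lapMatrix (h : 0 < linftyNorm (G.lapMatrix ℝ)) :
    2 ≤ linftyNorm (G.lapMatrix ℝ) := by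
  by_contra! hlt
  refine h.not_ge (linftyNorm_le le_rfl fun i => ?_)
  have h1 := sum_abs_le_linftyNorm (G.lapMatrix ℝ) i
  rw [sum_abs_lapMatrix] at h1 ⊢
  have h2 : (G.degree i : ℝ) < 1 := by linarith
  have h3 : G.degree i = 0 := by
    have : G.degree i < 1 := by exact_mod_cast h2
    omega
  simp [h3]

theorem energySq_lapMatrix (v : V → ℝ) : energySq (G.lapMatrix ℝ) v =
    (∑ i, ∑ j, if G.Adj i j then (v i - v j) ^ 2 else 0) / 2 := by
  rw [← SimpleGraph.lapMatrix_toLinearMap₂' ℝ G v, toLinearMap₂'_apply', energySq]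

/-! ### The Poincaré inequality -/

theorem energySq_pos_of_connected {G : SimpleGraph V} [DecidableRel G.Adj] (hG : G.Connected)
    {v : V → ℝ} (hv : v ≠ 0) (hs : ∑ i, v i = 0) : 0 < energySq (G.lapMatrix ℝ) v := by
  have hpsd := SimpleGraph.posSemidef_lapMatrix ℝ G
  refine lt_of_le_of_ne (energySq_nonneg hpsd v) fun h => hv ?_
  have h1 := (SimpleGraph.lapMatrix_mulVec_eq_zero_iff_forall_reachable G).1
    (mulVec_eq_zero_of_energySq_eq_zero hpsd h.symm)
  ext i
  have h2 : ∀ j, v j = v i := fun j => h1 j i (hG.preconnected j i)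
  simp only [h2, Finset.sum_const, nsmul_eq_mul, mul_eq_zero] at hs
  rcases hs with hs | hs
  · have : Nonempty V := ⟨i⟩
    exact absurd hs (by simp)
  · exact hs

/-- The spectral gap of a connected graph, as the infimum of the Rayleigh quotient. -/
theorem normSq_le_inv_sInf_mul_energySq {G : SimpleGraph V} [DecidableRel G.Adj]
    (hG : G.Connected) (v : V → ℝ) (hs : ∑ i, v i = 0) :
    normSq v ≤ (sInf {r : ℝ | ∃ v : V → ℝ, v ≠ 0 ∧ ∑ i, v i = 0 ∧
      r = energySq (G.lapMatrix ℝ) v / normSq v})⁻¹ * energySq (G.lapMatrix ℝ) v := by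
  by_cases hv : v = 0
  · subst hv; simp [normSq, energySq]
  -- The Rayleigh quotient is homogeneous of degree zero, so it can be minimized on the sphere of
  -- the maximum norm. The minimum is positive by connectedness, so the inverse of the infimum is a
  -- genuine one.
  have hK : IsCompact (Metric.sphere (0 : V → ℝ) 1 ∩ {v | ∑ i, v i = 0}) :=
    (isCompact_sphere _ _).inter_right (isClosed_eq (by fun_prop) continuous_const)
  have hscale : ∀ v : V → ℝ, v ≠ 0 → ∑ i, v i = 0 →
      (‖v‖⁻¹ • v) ∈ Metric.sphere (0 : V → ℝ) 1 ∩ {v | ∑ i, v i = 0} ∧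
      energySq (G.lapMatrix ℝ) (‖v‖⁻¹ • v) / normSq (‖v‖⁻¹ • v) =
        energySq (G.lapMatrix ℝ) v / normSq v := by
    intro v hv hs
    have hn := norm_ne_zero_iff.2 hv
    refine ⟨⟨?_, ?_⟩, ?_⟩
    · rw [mem_sphere_zero_iff_norm, norm_smul, norm_inv, norm_norm, inv_mul_cancel₀ hn]
    · simp [← Finset.mul_sum, hs]
    · have := (normSq_pos hv).ne'
      simp only [energySq, normSq, mulVec_smul, dotProduct_smul, smul_dotProduct,
        smul_eq_mul] at this ⊢
      field_simp
  have hcont : ContinuousOn (fun v : V → ℝ => energySq (G.lapMatrix ℝ) v / normSq v)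
      (Metric.sphere (0 : V → ℝ) 1 ∩ {v | ∑ i, v i = 0}) := by
    refine ContinuousOn.div ?_ ?_ fun x hx => (normSq_pos ?_).ne'
    · unfold energySq; fun_prop
    · unfold normSq; fun_prop
    · rintro rfl
      simpa using hx.1
  obtain ⟨v₀, hv₀, hmin⟩ := hK.exists_isMinOn ⟨_, (hscale v hv hs).1⟩ hcont
  have hv₀0 : v₀ ≠ 0 := by
    rintro rfl
    simpa using hv₀.1
  have hpos : 0 < energySq (G.lapMatrix ℝ) v₀ / normSq v₀ :=
    div_pos (energySq_pos_of_connected hG hv₀0 hv₀.2) (normSq_pos hv₀0)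
  have hlb : ∀ r ∈ {r : ℝ | ∃ v : V → ℝ, v ≠ 0 ∧ ∑ i, v i = 0 ∧
      r = energySq (G.lapMatrix ℝ) v / normSq v},
      energySq (G.lapMatrix ℝ) v₀ / normSq v₀ ≤ r := by
    rintro r ⟨v, hv, hs, rfl⟩
    rw [← (hscale v hv hs).2]
    exact hmin (hscale v hv hs).1
  have hmem : energySq (G.lapMatrix ℝ) v / normSq v ∈ {r : ℝ | ∃ v : V → ℝ, v ≠ 0 ∧
      ∑ i, v i = 0 ∧ r = energySq (G.lapMatrix ℝ) v / normSq v} := ⟨v, hv, hs, rfl⟩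
  have h1 := csInf_le ⟨_, hlb⟩ hmem
  have h2 := lt_of_lt_of_le hpos (le_csInf ⟨_, hmem⟩ hlb)
  rw [le_div_iff₀ (normSq_pos hv)] at h1
  rwa [inv_mul_eq_div, le_div_iff₀' h2]

end Laplacian

/-! ### Averaging over aggregates -/

section Aggregation

variable [DecidableEq W]

theorem avgProj_eq_prolongation_mulVec [Fintype W] (agg : V → W) (v : V → ℝ) :
    avgProj agg v = prolongation agg *ᵥ fun l =>
      (∑ j with agg j = l, v j) / ((Finset.univ.filter fun j => agg j = l).card : ℝ) := by
  ext i
  simp [avgProj, prolongation, mulVec, dotProduct]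

theorem sum_eq_sum_aggregates [Fintype W] (agg : V → W) (f : V → ℝ) :
    ∑ i, f i = ∑ l, ∑ i : {i : V | agg i = l}, f i := by
  rw [← Finset.sum_fiberwise Finset.univ agg f]
  refine Finset.sum_congr rfl fun l _ => ?_
  exact Finset.sum_subtype _ (by simp) _

theorem sum_aggregate_le (agg : V → W) (l : W) {f : V → ℝ} (hf : ∀ i, 0 ≤ f i) :
    ∑ i : {i : V | agg i = l}, f i ≤ ∑ i, f i := by
  rw [← Finset.sum_subtype (Finset.univ.filter fun i => agg i = l) (by simp) f]
  exact Finset.sum_le_sum_of_subset_of_nonneg (Finset.filter_subset _ _) fun i _ _ => hf i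

theorem sum_aggregate_sub_avgProj (agg : V → W) (v : V → ℝ) (l : W) :
    ∑ i : {i : V | agg i = l}, (v i - avgProj agg v i) = 0 := by
  rw [← Finset.sum_subtype (Finset.univ.filter fun i => agg i = l) (by simp)
    (fun i => v i - avgProj agg v i), Finset.sum_sub_distrib]
  have h : ∀ i ∈ Finset.univ.filter (fun i => agg i = l), avgProj agg v i =
      (∑ j with agg j = l, v j) / ((Finset.univ.filter fun j => agg j = l).card : ℝ) := by
    intro i hi
    have hi' : agg i = l := by simpa using hi
    rw [avgProj, hi']
  rw [Finset.sum_congr rfl h, Finset.sum_const, nsmul_eq_mul]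
  rcases (Finset.univ.filter fun j => agg j = l).eq_empty_or_nonempty with he | he
  · simp [he]
  · have : ((Finset.univ.filter fun j => agg j = l).card : ℝ) ≠ 0 := by
      exact_mod_cast he.card_pos.ne'
    field_simp
    simp

theorem weakApprox_of_localEigenvalue [DecidableEq V] [Fintype W] {G : SimpleGraph V}
    [DecidableRel G.Adj] {agg : V → W} (hagg : IsGraphPartition G agg) {cp : ℝ}
    (h : ∀ l, (localEigenvalue G agg l)⁻¹ ≤ cp) :
    WeakApprox (G.lapMatrix ℝ) (avgProj agg) cp := by
  intro v
  have hloc : ∀ l, ∑ i : {i : V | agg i = l}, (v i - avgProj agg v i) ^ 2 ≤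
      cp * ((∑ i : {i : V | agg i = l}, ∑ j : {i : V | agg i = l},
        if G.Adj i j then (v i - v j) ^ 2 else 0) / 2) := by
    intro l
    have h1 := normSq_le_inv_sInf_mul_energySq (hagg l) (fun i => v i - avgProj agg v i)
      (sum_aggregate_sub_avgProj agg v l)
    have h2 := h1.trans (mul_le_mul_of_nonneg_right (h l)
      (energySq_nonneg (SimpleGraph.posSemidef_lapMatrix ℝ _) _))
    rw [energySq_lapMatrix] at h2
    -- The average is constant on an aggregate, so `v - Q v` and `v` have the same local energy.
    -- Summing over aggregates then only drops the edges between them.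
    have e : ∀ i j : {i : V | agg i = l}, avgProj agg v i = avgProj agg v j := by
      rintro ⟨i, hi⟩ ⟨j, hj⟩
      change agg i = l at hi
      change agg j = l at hj
      simp only [avgProj, hi, hj]
    have e1 : ∑ i : {i : V | agg i = l}, (v i - avgProj agg v i) ^ 2 =
        normSq (fun i : {i : V | agg i = l} => v i - avgProj agg v i) := by
      simp only [normSq, dotProduct, sq]
    rw [e1]
    refine h2.trans (le_of_eq ?_)
    congr 2
    refine Finset.sum_congr rfl fun i _ => Finset.sum_congr rfl fun j _ => ?_
    rw [e i j, sub_sub_sub_cancel_right]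
    rfl
  rcases isEmpty_or_nonempty W with hW | ⟨⟨l₀⟩⟩
  · have : IsEmpty V := agg.isEmpty
    simp [normSq, energySq, dotProduct]
  have hcp : 0 ≤ cp := by
    refine le_trans (inv_nonneg.2 (Real.sInf_nonneg ?_)) (h l₀)
    rintro _ ⟨f, hf, _, rfl⟩
    exact div_nonneg (energySq_nonneg (SimpleGraph.posSemidef_lapMatrix ℝ _) _) (normSq_pos hf).le
  have hnn : ∀ i j, 0 ≤ if G.Adj i j then (v i - v j) ^ 2 else 0 := fun i j => by positivity
  have h1 : normSq (v - avgProj agg v) =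
      ∑ l, ∑ i : {i : V | agg i = l}, (v i - avgProj agg v i) ^ 2 := by
    rw [← sum_eq_sum_aggregates agg (fun i => (v i - avgProj agg v i) ^ 2)]
    simp only [normSq, dotProduct, sq, Pi.sub_apply]
  rw [h1, energySq_lapMatrix]
  refine (Finset.sum_le_sum fun l _ => hloc l).trans ?_
  rw [← Finset.mul_sum, ← Finset.sum_div]
  gcongr
  rw [sum_eq_sum_aggregates agg]
  exact Finset.sum_le_sum fun l _ => Finset.sum_le_sum fun i _ =>
    sum_aggregate_le agg l (hnn i)

end Aggregation

/-! ### From stability and weak approximation to the combined assumption -/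

theorem ApproxStable.of_energyStable {A : Matrix V V ℝ} (hA : A.PosSemidef)
    {Q : (V → ℝ) → V → ℝ} {cp c₀ : ℝ} (hcp : 0 < cp) (h₀ : EnergyStable A Q c₀)
    (h : WeakApprox A Q cp) : ApproxStable A Q cp (2 * c₀ + 3) := by
  intro v
  have h1 : cp⁻¹ * normSq (v - Q v) ≤ energySq A v := by
    rw [inv_mul_le_iff₀ hcp]; exact h v
  linarith [energySq_sub_le hA v (Q v), h₀ v]

end TwoLevel

/-! ### Assembly of the estimates -/

theorem mainTheorem2 (ρ : ℝ) (hρ₀ : 0 < ρ) (hρ₁ : ρ < 1) (θ : ℝ) (hθ : 1 ≤ θ) :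
    ∃ cnz : ℕ → ℝ, (∀ k, 0 < cnz k) ∧
      ∀ (V : Type*) [Fintype V] [DecidableEq V] (W : Type*) [Fintype W] [DecidableEq W]
        (G : SimpleGraph V) [DecidableRel G.Adj] (agg : V → W)
        (lam₀ : ℝ) (m : ℕ) (q : ℝ[X]),
        let A := G.lapMatrix ℝ
        let lam₁ := TwoLevel.linftyNorm A
        let Q := TwoLevel.avgProj agg
        let R := aeval A q
        let B := TwoLevel.preconditioner A R (TwoLevel.prolongation agg)
        let K := TwoLevel.twoGridConst (cnz (TwoLevel.maxRowNonzeros A))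
        G.Connected → TwoLevel.IsGraphPartition G agg →
        0 < lam₀ → lam₀ < lam₁ →
        TwoLevel.IsBestRecipApprox lam₀ lam₁ m q →
        2 ≤ m →
        TwoLevel.degreeBound ρ lam₀ lam₁ ≤ m →
        (m : ℝ) ≤ θ * (TwoLevel.degreeBound ρ lam₀ lam₁ + 1) →
        (∀ cp c₁ : ℝ, 0 < cp → TwoLevel.ApproxStable A Q cp c₁ →
          TwoLevel.SpectrallyEquivalent A B (K cp c₁ m)) ∧
        (∀ cp c₀ : ℝ, 0 < cp → TwoLevel.EnergyStable A Q c₀ → TwoLevel.WeakApprox A Q cp →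
          TwoLevel.ApproxStable A Q cp (2 * c₀ + 3) ∧
          TwoLevel.SpectrallyEquivalent A B (K cp (2 * c₀ + 3) m)) ∧
        (∀ cp : ℝ, (∀ l, (TwoLevel.localEigenvalue G agg l)⁻¹ ≤ cp) →
          TwoLevel.WeakApprox A Q cp) := by
  -- The graph enters the constant only through the bound `λ₁ ≤ 2 n_z`.
  choose C hC h using fun k : ℕ => TwoLevel.exists_le_log_sq_div_sq hρ₀ hθ (2 * (k : ℝ))
  refine ⟨C, hC, ?_⟩
  intro V _ _ W _ _ G _ agg lam₀ m q A lam₁ Q R B K _ hagg h0 h01 hq hm hmM hmθ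
  have hA : A.PosSemidef := SimpleGraph.posSemidef_lapMatrix ℝ G
  have hlam2 : 2 ≤ lam₁ := TwoLevel.two_le_linftyNorm_lapMatrix G (h0.trans h01)
  have hlam := h (TwoLevel.maxRowNonzeros A) lam₀ lam₁ m h0 h01 hlam2
    (TwoLevel.linftyNorm_lapMatrix_le G) hm hmθ
  have hmain : ∀ cp c₁ : ℝ, 0 < cp → TwoLevel.ApproxStable A Q cp c₁ →
      TwoLevel.SpectrallyEquivalent A B (K cp c₁ m) := by
    intro cp c₁ hcp hst v
    obtain ⟨z, hz⟩ : ∃ z, Q v = TwoLevel.prolongation agg *ᵥ z :=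
      ⟨_, TwoLevel.avgProj_eq_prolongation_mulVec agg v⟩
    have hs := TwoLevel.spectralEquivalence_of_symbol_bounds hA h0.le
      (fun x v hv hx => TwoLevel.eigenvalue_le_linftyNorm hv hx)
      (fun x hx0 hxb => hq.symbol_bounds h0 h01 hlam2 (by omega) hmM hx0 hxb)
      (TwoLevel.prolongation agg) v z
    rw [← hz] at hs
    refine ⟨hs.1, hs.2.trans ?_⟩
    have h1 := hst v
    have hn : 0 ≤ TwoLevel.normSq (v - Q v) := Finset.sum_nonneg fun i _ => mul_self_nonneg _
    have he := TwoLevel.energySq_nonneg hA (v - Q v)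
    have hcs : 0 ≤ C (TwoLevel.maxRowNonzeros A) * (Real.log m ^ 2 / (m : ℝ) ^ 2) :=
      h0.le.trans hlam
    have hcn : 0 ≤ cp⁻¹ * TwoLevel.normSq (v - Q v) := by positivity
    have h2 : TwoLevel.normSq (v - Q v) ≤ cp * (c₁ * TwoLevel.energySq A v) := by
      rw [← inv_mul_le_iff₀ hcp]; linarith
    have h3 : lam₀ * TwoLevel.normSq (v - Q v) ≤
        C (TwoLevel.maxRowNonzeros A) * (Real.log m ^ 2 / (m : ℝ) ^ 2) *
          (cp * (c₁ * TwoLevel.energySq A v)) := mul_le_mul hlam h2 hn hcs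
    -- This sign allows the factor `4` to be relaxed to the `8` in `K_TG` without assuming a sign
    -- for `c₁`.
    have h4 : 0 ≤ lam₀ * TwoLevel.normSq (v - Q v) := by positivity
    simp only [K, TwoLevel.twoGridConst]
    linarith
  refine ⟨hmain, fun cp c₀ hcp hst hw => ?_, fun cp hcp =>
    TwoLevel.weakApprox_of_localEigenvalue hagg hcp⟩
  have := TwoLevel.ApproxStable.of_energyStable hA hcp hst hw
  exact ⟨this, hmain _ _ hcp this⟩

end
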